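/- Let $k$ be a perfect field of characteristic $p>0$. For an integer $f$ and a $k$-vector space $U$ with a linear action of a group, let $U^{(f)}$ be the Frobenius twist: the same abelian group with the same group action, on which $\lambda\in k$ acts as $\lambda^{p^{-f}}$ did on $U$. For a ring $R$ of characteristic $p$ and $e\ge 0$ let ${}^eR$ be the abelian group $R$ with the $R$-module structure $r\cdot x=r^{p^e}x$. For a finite dimensional representation $W$ of $G$ over $k$ put $S=S(W)=\bigoplus_{l\ge 0}S^lW$ (symmetric algebra), $S_+=\bigoplus_{l>0}S^lW$, $R=S^G$; let $S_+^{[p^e]}$ be the ideal of $S$ generated by the $p^e$-th powers of the elements of $S_+$, and for a representation $U$ of $G$ let $R(U)=(S\otimes_k U)^G$, an $R$-module called a module of covariants. (A) Let $G$ be a finite group whose order is not divisible by $p$ and $W$ a finite dimensional representation of $G$ over $k$. 1. For every $e\ge 0$ there is an isomorphism of $R$-modules $${}^eR\cong\left((S/S_+^{[p^e]})^{(-e)}\otimes_k S\right)^G .$$ In particular, since $(S/S_+^{[p^e]})^{(-e)}$ is finite dimensional over $k$, ${}^eR$ is the module of covariants of a finite dimensional representation. 2. Up to isomorphism there are only finitely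 many irreducible representations of $G$ over $k$ that occur in $(S^lW)^{(f)}$ for some $l\ge 0$ and some $f\in\mathbb Z$. Let $U_1,\dots,U_n$ be the list of these, each isomorphism class listed once. Then for every $e\ge 0$ the $R$-module ${}^eR$ is isomorphic to a finite direct sum of copies of the $R(U_i)$, and conversely for every $i$ there is an $e\ge 0$ such that $R(U_i)$ is isomorphic to a direct summand of the $R$-module ${}^eR$. (B) Let $G$ be a split torus over $k$ with character group $X(G)$, written additively, and $W$ a finite dimensional (algebraic) representation of $G$. For $\chi\in X(G)$ let $L_\chi$ be the one-dimensional representation with character $\chi$. Let $\alpha_1,\dots,\alpha_d$ be the weights of $W$, repeated according to multiplicity, so that $d=\dim_k W$. Call $\chi\in X(G)$ strongly critical with respect to $W$ if $\chi=\sum_i u_i\alpha_i$ in $X(G)\otimes_{\mathbb Z}\mathbb Q$ for some $u_i\in\,]-1,0]\cap\mathbb Q$. There are only finitely many characters $\chi\in X(G)$ that are strongly critical with respect to $W$ and are weights of some $S^lW$, $l\ge 0$; call them $\chi_1,\dots,\chi_n$. Then for every $e\ge 0$ the $R$-module ${}^eR$ is isomorphic to a finite direct sum of copies of the $R(L_{-\chi_i})$,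 and conversely for every $i$ there is an $e\ge 0$ such that $R(L_{-\chi_i})$ is isomorphic to a direct summand of the $R$-module ${}^eR$. -/

import Mathlib

open scoped TensorProduct

noncomputable section

/-! ### Restriction of scalars and Frobenius twists -/

/-- The abelian group `M` of an `S`-module, to be regarded as an `R`-module by pulling the
structure back along `φ : R →+* S`. -/
def Pullback {R S : Type*} [Semiring R] [Semiring S] (_φ : R →+* S) (M : Type*) : Type _ := M

namespace Pullback

variable {R S : Type*} [Semiring R] [Semiring S] (φ : R →+* S) (M : Type*)

instance [AddCommGroup M] : AddCommGroup (Pullback φ M) := inferInstanceAs (AddCommGroup M)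

instance [AddCommGroup M] [Module S M] : Module R (Pullback φ M) := Module.compHom M φ

/-- The identity map, from `M` to its pullback. -/
def of [AddCommGroup M] : M ≃+ Pullback φ M := AddEquiv.refl M

theorem smul_of [AddCommGroup M] [Module S M] (r : R) (m : M) :
    r • of φ M m = of φ M (φ r • m) := rfl

end Pullback

/-- `ᵉM`: the abelian group `M` on which `r : R` acts as `r ^ (p ^ e)`. -/
abbrev FrobeniusModule (p : ℕ) (R : Type*) [CommSemiring R] [ExpChar R p] (e : ℕ) (M : Type*) :
    Type _ :=
  Pullback (iterateFrobenius R p e) M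

theorem FrobeniusModule.smul_of (p : ℕ) (R : Type*) [CommSemiring R] [ExpChar R p] (e : ℕ)
    (M : Type*) [AddCommGroup M] [Module R M] (r : R) (m : M) :
    r • Pullback.of (iterateFrobenius R p e) M m =
      Pullback.of (iterateFrobenius R p e) M (r ^ p ^ e • m) := rfl

/-- `U⁽ᶠ⁾` for an integer `f` and a vector space `U` over a perfect field `k`: the abelian group
`U` on which `a : k` acts as the image of `a` under the `(-f)`-th power of the Frobenius
automorphism of `k`. -/
abbrev FrobeniusTwist (p : ℕ) (k : Type*) [Field k] [ExpChar k p] [PerfectField k] (f : ℤ)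
    (U : Type*) : Type _ :=
  Pullback (((frobeniusEquiv k p : RingAut k) ^ (-f) : RingAut k) : k →+* k) U

theorem FrobeniusTwist.neg_smul_of (p : ℕ) (k : Type*) [Field k] [ExpChar k p] [PerfectField k]
    (e : ℕ) (U : Type*) [AddCommGroup U] [Module k U] (a : k) (u : U) :
    a • (Pullback.of _ U u : FrobeniusTwist p k (-(e : ℤ)) U) =
      Pullback.of _ U (a ^ p ^ e • u) := by
  rw [Pullback.smul_of]
  congr 2
  rw [neg_neg, zpow_natCast, ← iterateFrobeniusEquiv_eq_pow]
  rfl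

/-- The twisted representation: the group acts on `U⁽ᶠ⁾` by the same additive maps as on `U`. -/
def Representation.frobeniusTwist (p : ℕ) {k G U : Type*} [Field k] [ExpChar k p] [PerfectField k]
    [Group G] [AddCommGroup U] [Module k U] (σ : Representation k G U) (f : ℤ) :
    Representation k G (FrobeniusTwist p k f U) where
  toFun g :=
    { toFun := fun u => (σ g (show U from u) : U)
      map_add' := fun u v => (σ g).map_add u v
      map_smul' := fun a u =>
        (σ g).map_smul (((frobeniusEquiv k p : RingAut k) ^ (-f) : RingAut k) a) u }
  map_one' := by ext u; exact LinearMap.congr_fun (map_one σ) u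
  map_mul' g h := by ext u; exact LinearMap.congr_fun (map_mul σ g h) u

/-! ### The symmetric algebra -/

section Sym

variable (k W : Type*) [Field k] [AddCommGroup W] [Module k W]

/-- The homogeneous component `S^l W` of the symmetric algebra. -/
def symPow (l : ℕ) : Submodule k (SymmetricAlgebra k W) :=
  LinearMap.range (SymmetricAlgebra.ι k W) ^ l

/-- The ideal `S₊`, generated by the elements of positive degree (equivalently, of degree one). -/
def symPos : Ideal (SymmetricAlgebra k W) :=
  Ideal.span (⋃ l > 0, (symPow k W l : Set (SymmetricAlgebra k W)))

/-- The ideal generated by the `q`-th powers of the elements of `S₊`. -/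
def symPosFrobeniusPower (q : ℕ) : Ideal (SymmetricAlgebra k W) :=
  Ideal.span ((fun s => s ^ q) '' (symPos k W : Set (SymmetricAlgebra k W)))

instance symSubalgebraExpChar (p : ℕ) [ExpChar k p] (A : Subalgebra k (SymmetricAlgebra k W)) :
    ExpChar A p :=
  expChar_of_injective_algebraMap (algebraMap k A).injective p

end Sym

/-! ### Abstract groups: action on the symmetric algebra, invariants, covariants -/

namespace Representation

variable {k G W U : Type*} [Field k] [Group G] [AddCommGroup W] [Module k W]
  [AddCommGroup U] [Module k U] (ρ : Representation k G W) (σ : Representation k G U)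

/-- The action of a group element on `S(W)` by an algebra endomorphism. -/
def symHom (g : G) : SymmetricAlgebra k W →ₐ[k] SymmetricAlgebra k W :=
  SymmetricAlgebra.lift (SymmetricAlgebra.ι k W ∘ₗ ρ g)

/-- The representation of `G` on `S(W)`. -/
def sym : Representation k G (SymmetricAlgebra k W) where
  toFun g := (ρ.symHom g).toLinearMap
  map_one' := by
    have : ρ.symHom 1 = AlgHom.id k _ := by
      apply SymmetricAlgebra.algHom_ext; ext w; simp [symHom]
    rw [this]; rfl
  map_mul' g h := by
    have : ρ.symHom (g * h) = (ρ.symHom g).comp (ρ.symHom h) := by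
      apply SymmetricAlgebra.algHom_ext; ext w; simp [symHom]
    rw [this]; rfl

theorem sym_apply (g : G) (s : SymmetricAlgebra k W) : ρ.sym g s = ρ.symHom g s := rfl

theorem symPow_le_comap (l : ℕ) (g : G) :
    symPow k W l ≤ (symPow k W l).comap (ρ.sym g) := by
  rw [← Submodule.map_le_iff_le_comap]
  change ((LinearMap.range (SymmetricAlgebra.ι k W)) ^ l).map (ρ.symHom g).toLinearMap ≤ _
  rw [Submodule.map_pow]
  refine pow_le_pow_left₀ bot_le ?_ l
  rintro _ ⟨_, ⟨w, rfl⟩, rfl⟩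
  exact ⟨ρ g w, by simp [symHom]⟩

/-- The representation of `G` on `S^l W`. -/
def symPow (l : ℕ) : Representation k G (symPow k W l) :=
  ρ.sym.subrepresentation _ (ρ.symPow_le_comap l)

theorem symPos_le_comap (g : G) : symPos k W ≤ (symPos k W).comap (ρ.symHom g) := by
  refine Ideal.span_le.2 fun s hs => ?_
  simp only [Set.mem_iUnion] at hs
  obtain ⟨l, hl, hs⟩ := hs
  refine Ideal.subset_span ?_
  simp only [Set.mem_iUnion]
  exact ⟨l, hl, ρ.symPow_le_comap l g hs⟩

theorem symPosFrobeniusPower_le_comap (q : ℕ) (g : G) :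
    (symPosFrobeniusPower k W q).restrictScalars k ≤
      ((symPosFrobeniusPower k W q).restrictScalars k).comap (ρ.sym g) := by
  have : symPosFrobeniusPower k W q ≤ (symPosFrobeniusPower k W q).comap (ρ.symHom g) := by
    refine Ideal.span_le.2 ?_
    rintro _ ⟨s, hs, rfl⟩
    exact Ideal.subset_span ⟨ρ.symHom g s, ρ.symPos_le_comap g hs, (map_pow _ _ _).symm⟩
  exact this

/-- The representation of `G` on the quotient of `S(W)` by the ideal generated by the `q`-th
powers of the elements of `S₊`. -/
def symTruncated (q : ℕ) : Representation k G
    (SymmetricAlgebra k W ⧸ (symPosFrobeniusPower k W q).restrictScalars k) :=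
  ρ.sym.quotient _ (ρ.symPosFrobeniusPower_le_comap q)

/-- The ring of invariants `R = S(W)^G`. -/
def symInvariants : Subalgebra k (SymmetricAlgebra k W) where
  carrier := {s | ∀ g, ρ.sym g s = s}
  mul_mem' {a b} ha hb g := by
    have ha := ha g
    have hb := hb g
    simp only [sym_apply] at *
    rw [map_mul, ha, hb]
  add_mem' {a b} ha hb g := by rw [map_add, ha g, hb g]
  algebraMap_mem' a g := by rw [sym_apply, AlgHom.commutes]

theorem sym_tprod_smul (g : G) (r : ρ.symInvariants) (x : SymmetricAlgebra k W ⊗[k] U) :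
    (ρ.sym.tprod σ) g (r • x) = r • (ρ.sym.tprod σ) g x := by
  induction x with
  | zero => simp
  | add x y hx hy => rw [smul_add, map_add, hx, hy, map_add, smul_add]
  | tmul s u =>
    have hr := r.2 g
    change (ρ.symHom g (r.1 * s)) ⊗ₜ[k] σ g u = (r.1 * ρ.symHom g s) ⊗ₜ[k] σ g u
    rw [sym_apply] at hr
    rw [map_mul, hr]

/-- The module of covariants `R(U) = (S(W) ⊗ U)^G`, as an `R`-module. -/
def covariants : Submodule ρ.symInvariants (SymmetricAlgebra k W ⊗[k] U) where
  carrier := {x | ∀ g, (ρ.sym.tprod σ) g x = x}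
  add_mem' {a b} ha hb g := by rw [map_add, ha g, hb g]
  zero_mem' g := map_zero _
  smul_mem' r x hx g := by rw [sym_tprod_smul, hx g]

/-- The representation `σ` is isomorphic to a subrepresentation of `τ`. -/
def OccursIn {V : Type*} [AddCommGroup V] [Module k V] (σ : Representation k G U)
    (τ : Representation k G V) : Prop :=
  ∃ i : IntertwiningMap σ τ, Function.Injective i

end Representation

/-! ### Affine group schemes: representations as comodules over the coordinate ring -/

section AffineGroup

variable (k H : Type*) [Field k] [CommRing H] [HopfAlgebra k H]

/-- The affine group scheme with coordinate ring `H` is a split torus: `H` is isomorphic, as a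
Hopf algebra, to the group algebra of `ℤ ^ r`, the coordinate ring of `𝔾ₘ ^ r`. -/
def IsSplitTorus : Prop :=
  ∃ r : ℕ, Nonempty (H ≃ₐc[k] AddMonoidAlgebra k (Fin r → ℤ))

/-- The character group of the affine group scheme with coordinate ring `H`, written additively:
characters are the group-like elements of `H`. -/
abbrev CharacterGroup : Type _ := Additive (GroupLike k H)

/-- A representation on `V` of the affine group scheme with coordinate ring `H`: a right
`H`-comodule structure. -/
structure Coaction (V : Type*) [AddCommGroup V] [Module k V] where
  toLinearMap : V →ₗ[k] V ⊗[k] H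
  coassoc : (TensorProduct.assoc k V H H).toLinearMap ∘ₗ toLinearMap.rTensor H ∘ₗ toLinearMap =
    (Coalgebra.comul (R := k) (A := H)).lTensor V ∘ₗ toLinearMap
  counit : (TensorProduct.rid k V).toLinearMap ∘ₗ
    (Coalgebra.counit (R := k) (A := H)).lTensor V ∘ₗ toLinearMap = LinearMap.id

variable {k H}

/-- The element of `H` underlying a character. -/
def CharacterGroup.val (χ : CharacterGroup k H) : H := (Additive.toMul χ).val

/-- The one-dimensional representation `L_χ` with character `χ`. -/
def CharacterGroup.rep (χ : CharacterGroup k H) : Coaction k H k where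
  toLinearMap := (TensorProduct.mk k k H).flip χ.val
  coassoc := by
    ext
    simp [CharacterGroup.val, (Additive.toMul χ).isGroupLikeElem_val.comul_eq_tmul_self]
  counit := by
    ext
    simp [CharacterGroup.val, (Additive.toMul χ).isGroupLikeElem_val.counit_eq_one]

namespace Coaction

variable {W U : Type*} [AddCommGroup W] [Module k W] [AddCommGroup U] [Module k U]
  (ρ : Coaction k H W) (σ : Coaction k H U)

/-- The coaction on `S(W)`, an algebra homomorphism. -/
def sym : SymmetricAlgebra k W →ₐ[k] SymmetricAlgebra k W ⊗[k] H :=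
  SymmetricAlgebra.lift ((SymmetricAlgebra.ι k W).rTensor H ∘ₗ ρ.toLinearMap)

/-- The ring of invariants `R = S(W)^G`. -/
def symInvariants : Subalgebra k (SymmetricAlgebra k W) :=
  AlgHom.equalizer ρ.sym Algebra.TensorProduct.includeLeft

/-- The coaction on `S(W) ⊗ U`: if `s ↦ ∑ sᵢ ⊗ aᵢ` and `u ↦ ∑ uⱼ ⊗ bⱼ`, then
`s ⊗ u ↦ ∑ (sᵢ ⊗ uⱼ) ⊗ aᵢ bⱼ`. -/
def symTensor : SymmetricAlgebra k W ⊗[k] U →ₗ[k] (SymmetricAlgebra k W ⊗[k] U) ⊗[k] H :=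
  (LinearMap.mul' k H).lTensor _ ∘ₗ
    (TensorProduct.tensorTensorTensorComm k (SymmetricAlgebra k W) H U H).toLinearMap ∘ₗ
    TensorProduct.map ρ.sym.toLinearMap σ.toLinearMap

theorem symTensor_smul (r : ρ.symInvariants) (x : SymmetricAlgebra k W ⊗[k] U) :
    ρ.symTensor σ (r • x) =
      ((LinearMap.mulLeft k r.1).rTensor U).rTensor H (ρ.symTensor σ x) := by
  induction x with
  | zero => simp
  | add x y hx hy => rw [smul_add, map_add, hx, hy, map_add, map_add]
  | tmul s u =>
    have hr : ρ.sym r.1 = r.1 ⊗ₜ 1 := r.2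
    change ρ.symTensor σ ((r.1 * s) ⊗ₜ[k] u) = _
    simp only [symTensor, LinearMap.comp_apply, TensorProduct.map_tmul, AlgHom.toLinearMap_apply,
      map_mul, hr]
    generalize ρ.sym s = y
    generalize σ.toLinearMap u = z
    induction y with
    | zero => simp
    | add y₁ y₂ h₁ h₂ => simp only [mul_add, TensorProduct.add_tmul, map_add, h₁, h₂]
    | tmul a h =>
      induction z with
      | zero => simp
      | add z₁ z₂ h₁ h₂ => simp only [TensorProduct.tmul_add, map_add, h₁, h₂]
      | tmul v h' => simp

/-- The module of covariants `R(U) = (S(W) ⊗ U)^G`, as an `R`-module. -/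
def covariants : Submodule ρ.symInvariants (SymmetricAlgebra k W ⊗[k] U) where
  carrier := {x | ρ.symTensor σ x = x ⊗ₜ 1}
  add_mem' {a b} ha hb := by
    simp only [Set.mem_ofPred_eq] at *
    rw [map_add, ha, hb, TensorProduct.add_tmul]
  zero_mem' := by simp
  smul_mem' r x hx := by
    simp only [Set.mem_ofPred_eq] at *
    rw [symTensor_smul, hx]
    rfl

/-- The character `χ` is a weight of `S^l W`. -/
def IsWeightOfSymPow (l : ℕ) (χ : CharacterGroup k H) : Prop :=
  ∃ s ∈ symPow k W l, s ≠ 0 ∧ ρ.sym s = s ⊗ₜ χ.val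

/-- The character `χ` is strongly critical with respect to `W`: if `α₁, …, α_d` are the weights
of `W` (repeated according to multiplicity, i.e. the weights of a basis of weight vectors), then
`χ = ∑ uᵢ αᵢ` in `X(G) ⊗ ℚ` for rational numbers `uᵢ` in the interval `]-1, 0]`. -/
def IsStronglyCritical (χ : CharacterGroup k H) : Prop :=
  ∃ (b : Module.Basis (Fin (Module.finrank k W)) k W)
    (α : Fin (Module.finrank k W) → CharacterGroup k H),
    (∀ i, ρ.toLinearMap (b i) = b i ⊗ₜ (α i).val) ∧
    ∃ u : Fin (Module.finrank k W) → ℚ, (∀ i, u i ∈ Set.Ioc (-1 : ℚ) 0) ∧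
      (1 : ℚ) ⊗ₜ[ℤ] χ = ∑ i, u i ⊗ₜ[ℤ] α i

end Coaction

end AffineGroup

/-- The `R`-module `M` is isomorphic to a direct summand of `N`. -/
def IsDirectSummandOf (R M N : Type*) [Ring R] [AddCommGroup M] [Module R M] [AddCommGroup N]
    [Module R N] : Prop :=
  ∃ (i : M →ₗ[R] N) (q : N →ₗ[R] M), q ∘ₗ i = LinearMap.id

end

noncomputable section

/-! ### The monomial basis of the symmetric algebra -/

namespace SymmetricAlgebra

open Module

variable {k W κ : Type*} [Field k] [AddCommGroup W] [Module k W] (b : Basis κ k W)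

/-! Write q = p^e. Since k is perfect and s ↦ s^q is additive, division of exponents by q makes S
free over its q-th powers, with basis the monomials x^r, 0 ≤ r_i < q (`frobeniusSum`). Both halves
of the theorem come from making this decomposition compatible with the group.

Finite groups. As |G| is invertible in k, the projection S → S/S₊^[q] has a G-equivariant graded
linear section t (`exists_graded_section`). The map s ⊗ u ↦ s^q t(u) is well defined over k exactly
because of the twist by -e. It is surjective by a graded Nakayama argument
(`frobeniusTensor_surjective`). It is injective because its source is generated by as many elements
as the rank of the free target (`frobeniusTensor_injective`). Taking invariants gives ᵉR as a module
of covariants. Maschke's theorem then splits it into the R(U) with U irreducible in the twisted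
truncated algebra, and such U occur in a twist of some S^l W. Conversely, there are only finitely
many irreducibles, so the twists of U repeat and U ≅ U^(-D) for arbitrarily large D
(`exists_equiv_twist`). If U occurs in (S^l W)^(f), it therefore also occurs in (S^l W)^(-e) with e
as large as desired. For l < p^e the space S^l W embeds in the truncation, and Maschke makes R(U) a
summand.

Tori. In a basis of weight vectors, ᵉR is the direct sum over r of {s : s^q x^r is invariant}
(`residualSum_bijective`). Since the character group is torsion free, such a summand is zero or the
space of weight χ, where qχ + ∑ r_i α_i = 0; this space is R(L_{-χ}). Here χ = ∑ (-r_i/q) α_i is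
strongly critical. Conversely, a strongly critical χ that is also a nonnegative integral combination
of the α_i satisfies such an equation for a suitable e (`exists_nsmul_add_eq_zero`), by an
elementary rounding argument. -/

theorem monomial_add (m n : κ →₀ ℕ) :
    b.symmetricAlgebra (m + n) = b.symmetricAlgebra m * b.symmetricAlgebra n := by
  simp [Basis.symmetricAlgebra, ← map_mul]

theorem monomial_zero : b.symmetricAlgebra 0 = 1 := by
  simp [Basis.symmetricAlgebra, ← MvPolynomial.one_def]

theorem monomial_single (i : κ) : b.symmetricAlgebra (Finsupp.single i 1) = ι k W (b i) := by
  have := equivMvPolynomial_symm_X b i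
  simpa [Basis.symmetricAlgebra, MvPolynomial.X] using this

theorem monomial_nsmul (n : ℕ) (m : κ →₀ ℕ) :
    b.symmetricAlgebra (n • m) = b.symmetricAlgebra m ^ n := by
  induction n with
  | zero => simp [monomial_zero]
  | succ n ih => rw [succ_nsmul, monomial_add, ih, pow_succ]

theorem range_ι_eq_span :
    LinearMap.range (ι k W) = Submodule.span k (Set.range fun i => ι k W (b i)) := by
  rw [LinearMap.range_eq_map, ← b.span_eq, Submodule.map_span, ← Set.range_comp]
  rfl

theorem symPow_eq_span (l : ℕ) :
    symPow k W l = Submodule.span k (b.symmetricAlgebra '' {m | m.degree = l}) := by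
  induction l with
  | zero =>
    have : {m : κ →₀ ℕ | m.degree = 0} = {0} := by ext; simp [Finsupp.degree_eq_zero_iff]
    rw [this, Set.image_singleton, monomial_zero, symPow, pow_zero, Submodule.one_eq_span]
  | succ l ih =>
    rw [symPow, pow_succ, ← symPow, ih, range_ι_eq_span b, Submodule.span_mul_span]
    congr 1
    ext s
    simp only [Set.mem_mul, Set.mem_image, Set.mem_ofPred_eq, Set.mem_range]
    constructor
    · rintro ⟨_, ⟨m, hm, rfl⟩, _, ⟨i, rfl⟩, rfl⟩
      exact ⟨m + Finsupp.single i 1, by simp [hm], by rw [monomial_add, monomial_single]⟩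
    · rintro ⟨m, hm, rfl⟩
      have hne : m ≠ 0 := by rintro rfl; simp at hm
      obtain ⟨i, hi⟩ := Finsupp.ne_iff.1 hne
      have hle : Finsupp.single i 1 ≤ m := by
        simpa [Nat.one_le_iff_ne_zero] using hi
      refine ⟨_, ⟨m - Finsupp.single i 1, ?_, rfl⟩, _, ⟨i, rfl⟩, ?_⟩
      · have h := congrArg Finsupp.degree (tsub_add_cancel_of_le hle)
        rw [map_add, Finsupp.degree_single] at h
        omega
      · rw [← monomial_single, ← monomial_add, tsub_add_cancel_of_le hle]

theorem monomial_mem_symPow (m : κ →₀ ℕ) : b.symmetricAlgebra m ∈ symPow k W m.degree := by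
  rw [symPow_eq_span b]
  exact Submodule.subset_span ⟨m, rfl, rfl⟩

theorem mem_symPow_iff (l : ℕ) (s : SymmetricAlgebra k W) :
    s ∈ symPow k W l ↔ ∀ m, b.symmetricAlgebra.repr s m ≠ 0 → m.degree = l := by
  rw [symPow_eq_span b, Basis.mem_span_image]
  simp [Set.subset_def]

theorem iSup_symPow : ⨆ l, symPow k W l = ⊤ := by
  let b := Basis.ofVectorSpace k W
  rw [eq_top_iff, ← b.symmetricAlgebra.span_eq, Submodule.span_le]
  rintro _ ⟨m, rfl⟩
  exact Submodule.mem_iSup_of_mem _ (monomial_mem_symPow b m)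

instance expChar (p : ℕ) [ExpChar k p] : ExpChar (SymmetricAlgebra k W) p :=
  expChar_of_injective_algebraMap (algebraMap k _).injective p

/-! ### Division of exponents -/

section Exponents

/-- The exponents `m` with `m i < q` for all `i`. -/
abbrev Box (κ : Type*) (q : ℕ) : Type _ := κ → Fin q

variable [Finite κ] {q : ℕ}

/-- The exponent in the box, as a finitely supported function. -/
def Box.exp (r : Box κ q) : κ →₀ ℕ :=
  Finsupp.equivFunOnFinite.symm fun i => (r i : ℕ)

@[simp] theorem Box.exp_apply (r : Box κ q) (i : κ) : r.exp i = r i := rfl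

/-- The remainder of an exponent. -/
def boxMod (hq : 0 < q) (m : κ →₀ ℕ) : Box κ q := fun i => ⟨m i % q, Nat.mod_lt _ hq⟩

/-- The quotient of an exponent. -/
def expDiv (q : ℕ) (m : κ →₀ ℕ) : κ →₀ ℕ := m.mapRange (· / q) (Nat.zero_div q)

theorem nsmul_expDiv_add (hq : 0 < q) (m : κ →₀ ℕ) : q • expDiv q m + (boxMod hq m).exp = m := by
  ext i
  simp [expDiv, boxMod, Nat.div_add_mod]

/-- Uniqueness of division with remainder, coordinate by coordinate: each monomial is (x^m)^q x^r
for exactly one pair (m, r). -/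
theorem nsmul_add_exp_eq_iff (hq : 0 < q) (m n : κ →₀ ℕ) (r : Box κ q) :
    q • m + r.exp = n ↔ m = expDiv q n ∧ r = boxMod hq n := by
  constructor
  · rintro rfl
    constructor
    · ext i
      simp [expDiv, Nat.mul_add_div hq, Nat.div_eq_of_lt (r i).2]
    · ext i
      simp [boxMod, Nat.mod_eq_of_lt (r i).2]
  · rintro ⟨rfl, rfl⟩
    exact nsmul_expDiv_add hq n

end Exponents

/-! ### The symmetric algebra as a module over its `q`-th powers -/

section Frobenius

variable {p : ℕ} [ExpChar k p] (e : ℕ)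

open Classical in
-- Both sides are additive in s, because q-th powers are, so it suffices to take s a monomial. Only
-- exponents congruent to r modulo q occur, hence terms with different r cannot cancel.
theorem repr_pow_mul_monomial [Finite κ] (s : SymmetricAlgebra k W) (r : Box κ (p ^ e)) (n : κ →₀ ℕ) :
    b.symmetricAlgebra.repr (s ^ p ^ e * b.symmetricAlgebra r.exp) n =
      if r = boxMod (expChar_pow_pos k p e) n then
        b.symmetricAlgebra.repr s (expDiv (p ^ e) n) ^ p ^ e else 0 := by
  have hq := expChar_pow_pos k p e
  have hs : s ∈ Submodule.span k (Set.range b.symmetricAlgebra) := by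
    rw [Basis.span_eq]; trivial
  induction hs using Submodule.span_induction with
  | zero => simp [zero_pow hq.ne']
  | add s t _ _ hs ht =>
    rw [add_pow_expChar_pow, add_mul, map_add, Finsupp.add_apply, hs, ht]
    split_ifs
    · rw [map_add, Finsupp.add_apply, add_pow_expChar_pow]
    · simp
  | smul c s _ hs =>
    rw [smul_pow, smul_mul_assoc, map_smul, Finsupp.smul_apply, hs]
    split_ifs
    · simp [mul_pow]
    · simp
  | mem s hs =>
    obtain ⟨m, rfl⟩ := hs
    rw [← monomial_nsmul, ← monomial_add, Basis.repr_self, Basis.repr_self,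
      Finsupp.single_apply, Finsupp.single_apply]
    simp only [nsmul_add_exp_eq_iff hq]
    split_ifs <;> simp_all [zero_pow hq.ne']

variable [Fintype κ] [DecidableEq κ]

theorem repr_sum_pow_mul_monomial (s : Box κ (p ^ e) → SymmetricAlgebra k W)
    (n : κ →₀ ℕ) :
    b.symmetricAlgebra.repr (∑ r, s r ^ p ^ e * b.symmetricAlgebra r.exp) n =
      b.symmetricAlgebra.repr (s (boxMod (expChar_pow_pos k p e) n)) (expDiv (p ^ e) n) ^ p ^ e := by
  rw [map_sum, Finsupp.finsetSum_apply]
  rw [Finset.sum_eq_single (boxMod (expChar_pow_pos k p e) n), repr_pow_mul_monomial, if_pos rfl]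
  · intro r _ hr
    rw [repr_pow_mul_monomial, if_neg hr]
  · simp

variable (p) in
/-- The map `(sᵣ) ↦ ∑ sᵣ ^ q xʳ`, linear over the symmetric algebra acting on the target through
`q`-th powers. -/
def frobeniusSum : (Box κ (p ^ e) → SymmetricAlgebra k W) →ₗ[SymmetricAlgebra k W]
    FrobeniusModule p (SymmetricAlgebra k W) e (SymmetricAlgebra k W) where
  toFun s := Pullback.of _ _ (∑ r, s r ^ p ^ e * b.symmetricAlgebra r.exp)
  map_add' s t := by
    rw [← map_add, ← Finset.sum_add_distrib]
    simp only [Pi.add_apply, add_pow_expChar_pow, add_mul]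
  map_smul' a s := by
    rw [RingHom.id_apply, FrobeniusModule.smul_of]
    simp only [Pi.smul_apply, smul_eq_mul, mul_pow, Finset.mul_sum, mul_assoc]

theorem frobeniusSum_injective : Function.Injective (frobeniusSum b p e) := by
  rw [injective_iff_map_eq_zero]
  intro s hs
  replace hs : ∑ r, s r ^ p ^ e * b.symmetricAlgebra r.exp = 0 := hs
  funext r
  apply b.symmetricAlgebra.repr.injective
  ext m
  have := repr_sum_pow_mul_monomial b e s (p ^ e • m + r.exp)
  have h := (nsmul_add_exp_eq_iff (expChar_pow_pos k p e) m _ r).1 rfl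
  rw [hs, ← h.1, ← h.2] at this
  simpa using (pow_eq_zero_iff (expChar_pow_pos k p e).ne').1 (by simpa using this.symm)

theorem frobeniusSum_surjective [PerfectRing k p] :
    Function.Surjective (frobeniusSum b p e) := by
  intro t
  obtain ⟨t, rfl⟩ := (Pullback.of _ _).surjective t
  have ht : t ∈ Submodule.span k (Set.range b.symmetricAlgebra) := by
    rw [Basis.span_eq]; trivial
  induction ht using Submodule.span_induction with
  | zero => exact ⟨0, by rw [map_zero, map_zero]⟩
  | add s t _ _ hs ht =>
    obtain ⟨s', hs⟩ := hs
    obtain ⟨t', ht⟩ := ht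
    exact ⟨s' + t', by rw [map_add, map_add, hs, ht]⟩
  | smul c s _ hs =>
    obtain ⟨s', hs⟩ := hs
    -- Perfectness enters here: c is the q-th power of a scalar, so multiplication by c is part of
    -- the S-action through q-th powers.
    refine ⟨algebraMap k (SymmetricAlgebra k W) ((iterateFrobeniusEquiv k p e).symm c) • s', ?_⟩
    rw [map_smul, hs, FrobeniusModule.smul_of, ← map_pow, ← iterateFrobeniusEquiv_def,
      RingEquiv.apply_symm_apply, algebraMap_smul]
  | mem s hs =>
    obtain ⟨m, rfl⟩ := hs
    refine ⟨Pi.single (boxMod (expChar_pow_pos k p e) m) (b.symmetricAlgebra (expDiv (p ^ e) m)), ?_⟩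
    change Pullback.of _ _ (∑ r, _) = _
    congr 1
    rw [Finset.sum_eq_single (boxMod (expChar_pow_pos k p e) m)]
    · rw [Pi.single_eq_same, ← monomial_nsmul, ← monomial_add, nsmul_expDiv_add]
    · intro r _ hr
      rw [Pi.single_eq_of_ne hr, zero_pow (expChar_pow_pos k p e).ne', zero_mul]
    · simp

end Frobenius

end SymmetricAlgebra

namespace SymmetricAlgebra

open Module

variable {k W κ : Type*} [Field k] [AddCommGroup W] [Module k W] (b : Basis κ k W)

/-! ### Monomial ideals -/

/-- The ideal spanned by the monomials with exponents in `D`, a set stable under addition of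
exponents. -/
def monomialIdeal (D : Set (κ →₀ ℕ)) (hD : ∀ m ∈ D, ∀ n, n + m ∈ D) :
    Ideal (SymmetricAlgebra k W) where
  __ := Submodule.span k (b.symmetricAlgebra '' D)
  smul_mem' a s hs := by
    have h : a * s ∈ Submodule.span k (Set.range b.symmetricAlgebra) *
        Submodule.span k (b.symmetricAlgebra '' D) :=
      Submodule.mul_mem_mul (by rw [Basis.span_eq]; trivial) hs
    rw [Submodule.span_mul_span] at h
    refine Submodule.span_mono ?_ h
    rintro _ ⟨_, ⟨n, rfl⟩, _, ⟨m, hm, rfl⟩, rfl⟩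
    exact ⟨n + m, hD m hm n, monomial_add b n m⟩

theorem mem_monomialIdeal {D : Set (κ →₀ ℕ)} {hD : ∀ m ∈ D, ∀ n, n + m ∈ D}
    {s : SymmetricAlgebra k W} :
    s ∈ monomialIdeal b D hD ↔ s ∈ Submodule.span k (b.symmetricAlgebra '' D) := Iff.rfl

/-- The exponents of the monomials divisible by the `q`-th power of a variable. -/
def bigExponents (κ : Type*) (q : ℕ) : Set (κ →₀ ℕ) := {m | ∃ i, q ≤ m i}

theorem symPos_le (s : SymmetricAlgebra k W) (hs : s ∈ symPos k W) :
    s ∈ Submodule.span k (b.symmetricAlgebra '' {m | m ≠ 0}) := by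
  have hD : ∀ m ∈ {m : κ →₀ ℕ | m ≠ 0}, ∀ n, n + m ∈ {m : κ →₀ ℕ | m ≠ 0} := by
    intro m hm n h
    exact hm (add_eq_zero.1 h).2
  have : symPos k W ≤ monomialIdeal b _ hD := by
    refine Ideal.span_le.2 fun s hs => ?_
    simp only [Set.mem_iUnion] at hs
    obtain ⟨l, hl, hs⟩ := hs
    rw [SetLike.mem_coe, symPow_eq_span b] at hs
    refine Submodule.span_mono (Set.image_mono ?_) hs
    rintro m hm rfl
    simp at hm
    omega
  exact this hs

theorem pow_mem_symPosFrobeniusPower (q : ℕ) (w : W) :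
    ι k W w ^ q ∈ symPosFrobeniusPower k W q := by
  refine Ideal.subset_span ⟨_, Ideal.subset_span ?_, rfl⟩
  simp only [Set.mem_iUnion]
  exact ⟨1, one_pos, by rw [symPow, pow_one]; exact ⟨w, rfl⟩⟩

theorem monomial_eq_pow_mul {q : ℕ} {m : κ →₀ ℕ} {i : κ} (h : q ≤ m i) :
    b.symmetricAlgebra m =
      ι k W (b i) ^ q * b.symmetricAlgebra (m - Finsupp.single i q) := by
  rw [← monomial_single, ← monomial_nsmul, ← monomial_add, Finsupp.smul_single, smul_eq_mul,
    mul_one, add_tsub_cancel_of_le (by simpa using h)]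

theorem monomial_mem_symPosFrobeniusPower {q : ℕ} {m : κ →₀ ℕ} (h : m ∈ bigExponents κ q) :
    b.symmetricAlgebra m ∈ symPosFrobeniusPower k W q := by
  obtain ⟨i, hi⟩ := h
  rw [monomial_eq_pow_mul b hi]
  exact Ideal.mul_mem_right _ _ (pow_mem_symPosFrobeniusPower q _)

section Frobenius

variable (p : ℕ) [ExpChar k p] (e : ℕ)

/-- The ideal is monomial because the q-th power of a sum of nonconstant monomials is the sum of
their q-th powers, each divisible by some x_i^q. -/
theorem symPosFrobeniusPower_eq_span :
    (symPosFrobeniusPower k W (p ^ e)).restrictScalars k =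
      Submodule.span k (b.symmetricAlgebra '' bigExponents κ (p ^ e)) := by
  apply le_antisymm
  · have hD : ∀ m ∈ bigExponents κ (p ^ e), ∀ n, n + m ∈ bigExponents κ (p ^ e) := by
      rintro m ⟨i, hi⟩ n
      exact ⟨i, hi.trans (by simp)⟩
    have : symPosFrobeniusPower k W (p ^ e) ≤ monomialIdeal b _ hD := by
      refine Ideal.span_le.2 ?_
      rintro _ ⟨s, hs, rfl⟩
      rw [SetLike.mem_coe, mem_monomialIdeal]
      have h := symPos_le b s hs
      clear hs
      dsimp only
      induction h using Submodule.span_induction with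
      | zero => rw [zero_pow (expChar_pow_pos k p e).ne']; exact zero_mem _
      | add s t _ _ hs ht => rw [add_pow_expChar_pow]; exact add_mem hs ht
      | smul c s _ hs => rw [smul_pow]; exact Submodule.smul_mem _ _ hs
      | mem s hs =>
        obtain ⟨m, hm, rfl⟩ := hs
        obtain ⟨i, hi⟩ := Finsupp.ne_iff.1 hm
        rw [← monomial_nsmul]
        refine Submodule.subset_span ⟨_, ⟨i, ?_⟩, rfl⟩
        simpa using Nat.le_mul_of_pos_right _ (Nat.pos_of_ne_zero hi)
    exact this
  · rw [Submodule.span_le]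
    rintro _ ⟨m, hm, rfl⟩
    exact monomial_mem_symPosFrobeniusPower b hm

variable (k W) in
/-- The truncated symmetric algebra `S / S₊^[q]`. -/
abbrev Truncated (q : ℕ) : Type _ :=
  SymmetricAlgebra k W ⧸ (symPosFrobeniusPower k W q).restrictScalars k

variable (k W) in
/-- The projection from `S` to `S / S₊^[q]`. -/
abbrev truncatedMk (q : ℕ) : SymmetricAlgebra k W →ₗ[k] Truncated k W q :=
  ((symPosFrobeniusPower k W q).restrictScalars k).mkQ

theorem truncatedMk_monomial_eq_zero {q : ℕ} {m : κ →₀ ℕ} (h : m ∈ bigExponents κ q) :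
    truncatedMk k W q (b.symmetricAlgebra m) = 0 :=
  (Submodule.Quotient.mk_eq_zero _).2 (monomial_mem_symPosFrobeniusPower b h)

open Classical in
/-- The projection of `S` to the span of the monomials with all exponents less than `q`. -/
def truncation (q : ℕ) : SymmetricAlgebra k W →ₗ[k] SymmetricAlgebra k W :=
  b.symmetricAlgebra.constr k fun m => if m ∈ bigExponents κ q then 0 else b.symmetricAlgebra m

open Classical in
theorem truncation_monomial (q : ℕ) (m : κ →₀ ℕ) : truncation b q (b.symmetricAlgebra m) =
    if m ∈ bigExponents κ q then 0 else b.symmetricAlgebra m := by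
  rw [truncation, Basis.constr_basis]

theorem truncation_eq_zero {s : SymmetricAlgebra k W}
    (hs : s ∈ (symPosFrobeniusPower k W (p ^ e)).restrictScalars k) :
    truncation b (p ^ e) s = 0 := by
  rw [symPosFrobeniusPower_eq_span b] at hs
  refine (Submodule.span_le (p := LinearMap.ker (truncation b (p ^ e)))).2 ?_ hs
  rintro _ ⟨m, hm, rfl⟩
  rw [SetLike.mem_coe, LinearMap.mem_ker, truncation_monomial, if_pos hm]

theorem truncatedMk_truncation (q : ℕ) (s : SymmetricAlgebra k W) :
    truncatedMk k W q (truncation b q s) = truncatedMk k W q s := by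
  suffices h : truncatedMk k W q ∘ₗ truncation b q = truncatedMk k W q from LinearMap.congr_fun h s
  refine b.symmetricAlgebra.ext fun m => ?_
  rw [LinearMap.comp_apply, truncation_monomial]
  split_ifs with h
  · rw [map_zero, truncatedMk_monomial_eq_zero b h]
  · rfl

theorem truncation_mem_symPow (q l : ℕ) {s : SymmetricAlgebra k W} (hs : s ∈ symPow k W l) :
    truncation b q s ∈ symPow k W l := by
  rw [symPow_eq_span b] at hs
  refine (Submodule.span_le (p := (symPow k W l).comap (truncation b q))).2 ?_ hs
  rintro _ ⟨m, rfl, rfl⟩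
  rw [SetLike.mem_coe, Submodule.mem_comap, truncation_monomial]
  split_ifs
  · exact zero_mem _
  · exact monomial_mem_symPow b m

/-- A linear section of the projection to the truncated symmetric algebra. -/
def truncatedSection : Truncated k W (p ^ e) →ₗ[k] SymmetricAlgebra k W :=
  Submodule.liftQ _ (truncation b (p ^ e)) fun _ hs => truncation_eq_zero b p e hs

end Frobenius

end SymmetricAlgebra

/-! ### Equivariant graded sections of the truncation -/

namespace Representation

open SymmetricAlgebra Module

variable {k G W : Type*} [Field k] [Group G] [AddCommGroup W] [Module k W]
  (ρ : Representation k G W) (p e : ℕ) [ExpChar k p]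

theorem symTruncated_mk (q : ℕ) (g : G) (s : SymmetricAlgebra k W) :
    ρ.symTruncated q g (truncatedMk k W q s) = truncatedMk k W q (ρ.sym g s) := rfl

/-- Average the conjugates g t₀ g⁻¹ of the monomial section t₀. Each conjugate is again a section
and preserves degrees, and both properties survive averaging. Degree preservation is what the
Nakayama argument needs later. -/
theorem exists_graded_section [Finite G] (hG : (Nat.card G : k) ≠ 0) :
    ∃ t : Truncated k W (p ^ e) →ₗ[k] SymmetricAlgebra k W,
      (∀ u, truncatedMk k W (p ^ e) (t u) = u) ∧
      (∀ l, ∀ s ∈ _root_.symPow k W l, t (truncatedMk k W (p ^ e) s) ∈ _root_.symPow k W l) ∧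
      ∀ g u, t (ρ.symTruncated (p ^ e) g u) = ρ.sym g (t u) := by
  have := Fintype.ofFinite G
  let b := Basis.ofVectorSpace k W
  let t₀ := truncatedSection b p e
  have ht₀ : ∀ u, truncatedMk k W (p ^ e) (t₀ u) = u := by
    intro u
    obtain ⟨s, rfl⟩ := Submodule.mkQ_surjective _ u
    exact truncatedMk_truncation b _ s
  refine ⟨(Nat.card G : k)⁻¹ • ∑ g : G, ρ.sym g ∘ₗ t₀ ∘ₗ ρ.symTruncated (p ^ e) g⁻¹, ?_, ?_, ?_⟩
  · intro u
    rw [LinearMap.smul_apply, LinearMap.sum_apply, map_smul, map_sum]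
    have (g : G) : truncatedMk k W (p ^ e)
        ((ρ.sym g ∘ₗ t₀ ∘ₗ ρ.symTruncated (p ^ e) g⁻¹) u) = u := by
      rw [LinearMap.comp_apply, ← symTruncated_mk, LinearMap.comp_apply, ht₀,
        Representation.self_inv_apply]
    simp only [this]
    rw [Finset.sum_const, Finset.card_univ, ← Nat.cast_smul_eq_nsmul k, smul_smul,
      ← Nat.card_eq_fintype_card, inv_mul_cancel₀ hG, one_smul]
  · intro l s hs
    rw [LinearMap.smul_apply, LinearMap.sum_apply]
    refine Submodule.smul_mem _ _ (Submodule.sum_mem _ fun g _ => ?_)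
    refine ρ.symPow_le_comap l g ?_
    rw [LinearMap.comp_apply, symTruncated_mk]
    exact truncation_mem_symPow b _ l (ρ.symPow_le_comap l g⁻¹ hs)
  · intro g u
    rw [LinearMap.smul_apply, LinearMap.sum_apply, LinearMap.smul_apply, LinearMap.sum_apply,
      map_smul, map_sum]
    congr 1
    refine Fintype.sum_equiv (Equiv.mulLeft g⁻¹) _ _ fun h => ?_
    simp only [LinearMap.comp_apply, Equiv.coe_mulLeft]
    rw [← Module.End.mul_apply, ← Module.End.mul_apply, ← map_mul, ← map_mul, mul_inv_cancel_left,
      mul_inv_rev, inv_inv]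

end Representation

/-! ### The symmetric algebra as the extension of its twisted truncation -/

namespace SymmetricAlgebra

open Module

variable {k W κ : Type*} [Field k] [AddCommGroup W] [Module k W] (b : Basis κ k W)
  (p e : ℕ) [ExpChar k p] [PerfectField k]

variable (k W) in
/-- The `(-e)`-th Frobenius twist of the truncated symmetric algebra. -/
abbrev TwistedTruncated : Type _ := FrobeniusTwist p k (-(e : ℤ)) (Truncated k W (p ^ e))

theorem twist_smul_iterateFrobeniusEquiv_symm (U : Type*) [AddCommGroup U] [Module k U] (c : k)
    (u : U) :
    (iterateFrobeniusEquiv k p e).symm c • (Pullback.of _ _ u : FrobeniusTwist p k (-(e : ℤ)) U) =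
      Pullback.of _ _ (c • u) := by
  rw [FrobeniusTwist.neg_smul_of, ← iterateFrobeniusEquiv_def, RingEquiv.apply_symm_apply]

/-- Supplies the bound q^d on the number of generators. Linear independence is not needed, since
injectivity is obtained by comparing with a free module of that rank. -/
theorem span_twistedTruncated_eq_top [Finite κ] :
    Submodule.span k (Set.range fun r : Box κ (p ^ e) =>
      (Pullback.of _ _ (truncatedMk k W (p ^ e) (b.symmetricAlgebra r.exp)) :
        TwistedTruncated k W p e)) = ⊤ := by
  rw [eq_top_iff]
  rintro u -
  obtain ⟨u, rfl⟩ := (Pullback.of _ _).surjective u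
  obtain ⟨s, rfl⟩ := Submodule.mkQ_surjective _ u
  have hs : s ∈ Submodule.span k (Set.range b.symmetricAlgebra) := by
    rw [Basis.span_eq]; trivial
  induction hs using Submodule.span_induction with
  | zero => rw [map_zero, map_zero]; exact zero_mem _
  | add s t _ _ hs ht => rw [map_add, map_add]; exact add_mem hs ht
  | smul c s _ hs =>
    rw [map_smul, ← twist_smul_iterateFrobeniusEquiv_symm]
    exact Submodule.smul_mem _ _ hs
  | mem s hs =>
    obtain ⟨m, rfl⟩ := hs
    by_cases hm : m ∈ bigExponents κ (p ^ e)
    · have := truncatedMk_monomial_eq_zero b hm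
      rw [this, map_zero]
      exact zero_mem _
    · refine Submodule.subset_span ⟨fun i => ⟨m i, ?_⟩, ?_⟩
      · by_contra h
        exact hm ⟨i, not_lt.1 h⟩
      · dsimp only
        congr 3
        ext i
        rfl

instance finite_twistedTruncated [Module.Finite k W] :
    Module.Finite k (TwistedTruncated k W p e) := by
  have := span_twistedTruncated_eq_top (Module.finBasis k W) p e
  exact ⟨⟨Set.finite_range _ |>.toFinset, by simpa using this⟩⟩

variable {p e}
variable (t : Truncated k W (p ^ e) →ₗ[k] SymmetricAlgebra k W)

variable (p e) in
/-- The inverse of the identity map from a vector space to its twist. -/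
abbrev untwist (U : Type*) [AddCommGroup U] [Module k U] :
    FrobeniusTwist p k (-(e : ℤ)) U ≃+ U :=
  (Pullback.of _ U).symm

theorem untwist_smul (U : Type*) [AddCommGroup U] [Module k U] (c : k)
    (u : FrobeniusTwist p k (-(e : ℤ)) U) : untwist p e U (c • u) = c ^ p ^ e • untwist p e U u := by
  obtain ⟨u, rfl⟩ := (Pullback.of _ _).surjective u
  rw [FrobeniusTwist.neg_smul_of, AddEquiv.symm_apply_apply, AddEquiv.symm_apply_apply]

/-- The additive map `s ⊗ u ↦ s ^ q t(u)`. -/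
def frobeniusTensorHom :
    SymmetricAlgebra k W ⊗[k] TwistedTruncated k W p e →+ SymmetricAlgebra k W :=
  TensorProduct.liftAddHom
    ((AddMonoidHom.mul.compl₂ (t.toAddMonoidHom.comp
      (untwist p e (Truncated k W (p ^ e))).toAddMonoidHom)).comp
        (iterateFrobenius (SymmetricAlgebra k W) p e).toAddMonoidHom)
    (by
      -- The factor c^q on the left agrees with the action of c on the twist, which is c^q on the
      -- untwisted space.
      intro c s u
      change (c • s) ^ p ^ e * t (untwist p e _ u) = s ^ p ^ e * t (untwist p e _ (c • u))
      rw [untwist_smul, map_smul, smul_pow, mul_smul_comm, smul_mul_assoc])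

theorem frobeniusTensorHom_tmul (s : SymmetricAlgebra k W) (u : TwistedTruncated k W p e) :
    frobeniusTensorHom t (s ⊗ₜ u) = s ^ p ^ e * t (untwist p e _ u) := rfl

theorem frobeniusTensorHom_smul (a : SymmetricAlgebra k W)
    (x : SymmetricAlgebra k W ⊗[k] TwistedTruncated k W p e) :
    frobeniusTensorHom t (a • x) = a ^ p ^ e * frobeniusTensorHom t x := by
  induction x with
  | zero => simp
  | add x y hx hy => rw [smul_add, map_add, map_add, mul_add, hx, hy]
  | tmul s u =>
    rw [TensorProduct.smul_tmul', frobeniusTensorHom_tmul, frobeniusTensorHom_tmul, smul_eq_mul,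
      mul_pow, mul_assoc]

/-- The map `s ⊗ u ↦ s ^ q t(u)`, linear over the symmetric algebra acting on the target through
`q`-th powers. -/
def frobeniusTensor : SymmetricAlgebra k W ⊗[k] TwistedTruncated k W p e →ₗ[SymmetricAlgebra k W]
    FrobeniusModule p (SymmetricAlgebra k W) e (SymmetricAlgebra k W) where
  toFun x := Pullback.of _ _ (frobeniusTensorHom t x)
  map_add' x y := by rw [map_add, map_add]
  map_smul' a x := by
    rw [RingHom.id_apply, FrobeniusModule.smul_of, frobeniusTensorHom_smul, smul_eq_mul]

theorem frobeniusTensor_tmul (s : SymmetricAlgebra k W) (u : Truncated k W (p ^ e)) :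
    frobeniusTensor t (s ⊗ₜ Pullback.of _ _ u) = Pullback.of _ _ (s ^ p ^ e * t u) := rfl

/-- Graded Nakayama, by strong induction on the degree of a monomial. Modulo the image of t, a
monomial may be replaced by a combination of monomials of the same degree lying in S₊^[q]. Each of
these is x_i^q times a monomial of smaller degree. -/
theorem frobeniusTensor_surjective
    (ht : ∀ u, truncatedMk k W (p ^ e) (t u) = u)
    (htl : ∀ l, ∀ s ∈ symPow k W l, t (truncatedMk k W (p ^ e) s) ∈ symPow k W l) :
    Function.Surjective (frobeniusTensor t) := by
  let κ := Basis.ofVectorSpaceIndex k W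
  let b : Basis κ k W := Basis.ofVectorSpace k W
  -- The range is a priori stable only under q-th powers; stability under all of k uses q-th roots
  -- of scalars.
  have hsmul (c : k) (s : SymmetricAlgebra k W)
      (hs : Pullback.of _ _ s ∈ LinearMap.range (frobeniusTensor t)) :
      Pullback.of _ _ (c • s) ∈ LinearMap.range (frobeniusTensor t) := by
    have := Submodule.smul_mem _ (algebraMap k (SymmetricAlgebra k W)
      ((iterateFrobeniusEquiv k p e).symm c)) hs
    rwa [FrobeniusModule.smul_of, ← map_pow, ← iterateFrobeniusEquiv_def,
      RingEquiv.apply_symm_apply, algebraMap_smul] at this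
  have hspan (D : Set (κ →₀ ℕ))
      (hD : ∀ m ∈ D, Pullback.of _ _ (b.symmetricAlgebra m) ∈ LinearMap.range (frobeniusTensor t))
      (s : SymmetricAlgebra k W) (hs : s ∈ Submodule.span k (b.symmetricAlgebra '' D)) :
      Pullback.of _ _ s ∈ LinearMap.range (frobeniusTensor t) := by
    induction hs using Submodule.span_induction with
    | zero => rw [map_zero]; exact zero_mem _
    | add s t _ _ hs ht => rw [map_add]; exact add_mem hs ht
    | smul c s _ hs => exact hsmul c s hs
    | mem s hs =>
      obtain ⟨m, hm, rfl⟩ := hs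
      exact hD m hm
  have key (l : ℕ) (m : κ →₀ ℕ) (hm : m.degree = l) :
      Pullback.of _ _ (b.symmetricAlgebra m) ∈ LinearMap.range (frobeniusTensor t) := by
    induction l using Nat.strong_induction_on generalizing m with
    | _ l ih =>
    have big (m : κ →₀ ℕ) (hm : m.degree = l) (h : m ∈ bigExponents κ (p ^ e)) :
        Pullback.of _ _ (b.symmetricAlgebra m) ∈ LinearMap.range (frobeniusTensor t) := by
      obtain ⟨i, hi⟩ := h
      rw [monomial_eq_pow_mul b hi, ← smul_eq_mul, ← FrobeniusModule.smul_of]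
      refine Submodule.smul_mem _ _ (ih _ ?_ _ rfl)
      have h := congrArg Finsupp.degree
        (tsub_add_cancel_of_le (show Finsupp.single i (p ^ e) ≤ m by simpa using hi))
      rw [map_add, Finsupp.degree_single] at h
      have := expChar_pow_pos k p e
      omega
    set s := t (truncatedMk k W (p ^ e) (b.symmetricAlgebra m))
    have hs : Pullback.of _ _ s ∈ LinearMap.range (frobeniusTensor t) :=
      ⟨1 ⊗ₜ Pullback.of _ _ (truncatedMk k W (p ^ e) (b.symmetricAlgebra m)), by
        rw [frobeniusTensor_tmul, one_pow, one_mul]⟩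
    have hsl : b.symmetricAlgebra m - s ∈ symPow k W l := by
      have := monomial_mem_symPow b m
      rw [hm] at this
      exact sub_mem this (htl l _ this)
    have hsI : b.symmetricAlgebra m - s ∈
        (symPosFrobeniusPower k W (p ^ e)).restrictScalars k := by
      rw [← Submodule.Quotient.mk_eq_zero]
      change truncatedMk k W (p ^ e) _ = 0
      rw [map_sub, ht, sub_self]
    rw [symPosFrobeniusPower_eq_span b, Basis.mem_span_image] at hsI
    rw [mem_symPow_iff b] at hsl
    rw [← sub_add_cancel (b.symmetricAlgebra m) s, map_add]
    refine add_mem (hspan {n | n.degree = l ∧ n ∈ bigExponents κ (p ^ e)}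
      (fun n hn => big n hn.1 hn.2) _ ?_) hs
    rw [Basis.mem_span_image]
    -- A monomial occurring in x^m - t(x^m) has degree l by gradedness and an exponent at least q by
    -- membership in S₊^[q].
    exact fun n hn => ⟨hsl n (by simpa using hn), hsI hn⟩
  intro s
  obtain ⟨s, rfl⟩ := (Pullback.of _ _).surjective s
  refine hspan Set.univ (fun m _ => key _ m rfl) s ?_
  rw [Set.image_univ, Basis.span_eq]
  trivial

/-- The composite S^box → S ⊗ (twisted truncation) → ᵉS ≅ S^box is a surjective endomorphism of a
finitely generated module, hence injective. As its first arrow is onto, the middle one is injective.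
-/
theorem frobeniusTensor_injective [Module.Finite k W]
    (hs : Function.Surjective (frobeniusTensor t)) :
    Function.Injective (frobeniusTensor t) := by
  let b := Module.finBasis k W
  let F := LinearEquiv.ofBijective (frobeniusSum b p e)
    ⟨frobeniusSum_injective b e, frobeniusSum_surjective b e⟩
  let Θ : (Box _ (p ^ e) → SymmetricAlgebra k W) →ₗ[SymmetricAlgebra k W]
      SymmetricAlgebra k W ⊗[k] TwistedTruncated k W p e :=
    Fintype.linearCombination (SymmetricAlgebra k W) fun r =>
      1 ⊗ₜ Pullback.of _ _ (truncatedMk k W (p ^ e) (b.symmetricAlgebra r.exp))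
  have hΘ : Function.Surjective Θ := by
    rw [← LinearMap.range_eq_top, Fintype.range_linearCombination,
      ← Submodule.baseChange_top, ← span_twistedTruncated_eq_top b p e, Submodule.baseChange_span,
      ← Set.range_comp]
    rfl
  have hinj := OrzechProperty.injective_of_surjective_endomorphism
    (F.symm.toLinearMap ∘ₗ frobeniusTensor t ∘ₗ Θ) (by
      rw [LinearMap.coe_comp, LinearMap.coe_comp]
      exact F.symm.surjective.comp (hs.comp hΘ))
  rw [LinearMap.coe_comp, LinearMap.coe_comp] at hinj
  exact (Function.Injective.of_comp hinj).of_comp_right hΘ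

end SymmetricAlgebra

/-! ### Passage to invariants -/

namespace Representation

open SymmetricAlgebra Module

variable {k G W : Type*} [Field k] [Group G] [AddCommGroup W] [Module k W]
  (ρ : Representation k G W) {p e : ℕ} [ExpChar k p] [PerfectField k]

/-- A shortcut for instance search. -/
local instance covariantsModule {U : Type*} [AddCommGroup U] [Module k U] (σ : Representation k G U) :
    Module ρ.symInvariants (ρ.covariants σ) := Submodule.module _

/-- A shortcut for instance search. -/
local instance covariantsSMul {U : Type*} [AddCommGroup U] [Module k U] (σ : Representation k G U) :
    SMul ρ.symInvariants (ρ.covariants σ) := (ρ.covariantsModule σ).toSMul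

theorem frobeniusTensorHom_equivariant {t : Truncated k W (p ^ e) →ₗ[k] SymmetricAlgebra k W}
    (ht : ∀ g u, t (ρ.symTruncated (p ^ e) g u) = ρ.sym g (t u)) (g : G)
    (x : SymmetricAlgebra k W ⊗[k] TwistedTruncated k W p e) :
    frobeniusTensorHom t
        ((ρ.sym.tprod ((ρ.symTruncated (p ^ e)).frobeniusTwist p (-(e : ℤ)))) g x) =
      ρ.sym g (frobeniusTensorHom t x) := by
  induction x with
  | zero => simp only [map_zero]
  | add x y hx hy => simp only [map_add, hx, hy]
  | tmul s u =>
    change (ρ.symHom g s) ^ p ^ e * t (ρ.symTruncated (p ^ e) g (untwist p e _ u)) =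
      ρ.symHom g (s ^ p ^ e * t (untwist p e _ u))
    rw [ht, map_mul, map_pow, sym_apply]

variable {t : Truncated k W (p ^ e) →ₗ[k] SymmetricAlgebra k W}
  (ht : ∀ g u, t (ρ.symTruncated (p ^ e) g u) = ρ.sym g (t u))

/-- The additive map from the covariants with values in the twisted truncated symmetric algebra
induced by an equivariant section. -/
def covariantsHom :
    ρ.covariants ((ρ.symTruncated (p ^ e)).frobeniusTwist p (-(e : ℤ))) →+ ρ.symInvariants :=
  AddMonoidHom.mk' (fun x => ⟨frobeniusTensorHom t x.1, fun g => by
    rw [← frobeniusTensorHom_equivariant ρ ht, x.2 g]⟩)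
    fun x y => Subtype.ext (map_add (frobeniusTensorHom t) x.1 y.1)

theorem covariantsHom_smul (r : ρ.symInvariants)
    (x : ρ.covariants ((ρ.symTruncated (p ^ e)).frobeniusTwist p (-(e : ℤ)))) :
    ρ.covariantsHom ht (r • x) = r ^ p ^ e • ρ.covariantsHom ht x :=
  Subtype.ext (frobeniusTensorHom_smul t r.1 x.1)

/-- The linear map from the covariants with values in the twisted truncated symmetric algebra
induced by an equivariant section. -/
def covariantsToFrobenius :
    ρ.covariants ((ρ.symTruncated (p ^ e)).frobeniusTwist p (-(e : ℤ))) →ₗ[ρ.symInvariants]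
      FrobeniusModule p ρ.symInvariants e ρ.symInvariants where
  toFun x := Pullback.of _ ρ.symInvariants (ρ.covariantsHom ht x)
  map_add' x y := by rw [map_add, map_add]
  map_smul' r x := by rw [covariantsHom_smul]; rfl

theorem nonempty_frobeniusModule_equiv_covariants [Finite G] [Module.Finite k W]
    (hG : (Nat.card G : k) ≠ 0) :
    Nonempty (FrobeniusModule p ρ.symInvariants e ρ.symInvariants ≃ₗ[ρ.symInvariants]
      ρ.covariants ((ρ.symTruncated (p ^ e)).frobeniusTwist p (-(e : ℤ)))) := by
  obtain ⟨t, ht, htl, htg⟩ := ρ.exists_graded_section p e hG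
  have hsurj : Function.Surjective (frobeniusTensorHom t) := frobeniusTensor_surjective t ht htl
  have hinj : Function.Injective (frobeniusTensorHom t) :=
    frobeniusTensor_injective t (frobeniusTensor_surjective t ht htl)
  refine ⟨(LinearEquiv.ofBijective (ρ.covariantsToFrobenius htg)
    ⟨fun x y h => ?_, fun r => ?_⟩).symm⟩
  · exact Subtype.ext (hinj (congrArg Subtype.val ((Pullback.of _ ρ.symInvariants).injective h)))
  · obtain ⟨r, rfl⟩ := (Pullback.of _ ρ.symInvariants).surjective r
    obtain ⟨x, hx⟩ := hsurj r.1
    -- The preimage of an invariant element is invariant: it and its translates have the same image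
    -- under an injective equivariant map.
    refine ⟨⟨x, fun g => hinj ?_⟩, congrArg (Pullback.of _ ρ.symInvariants) (Subtype.ext hx)⟩
    rw [frobeniusTensorHom_equivariant ρ htg, hx]
    exact r.2 g

end Representation

namespace Representation

open Module
open scoped MonoidAlgebra

/-! ### Complete reducibility -/

section Maschke

variable {k G : Type*} [Field k] [Group G] [Finite G] [NeZero (Nat.card G : k)]
  {U V : Type*} [AddCommGroup U] [Module k U] [AddCommGroup V] [Module k V]
  {σ : Representation k G U} {τ : Representation k G V}

theorem exists_leftInverse_of_injective (i : IntertwiningMap σ τ) (hi : Function.Injective i) :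
    ∃ q : IntertwiningMap τ σ, ∀ u, q (i u) = u := by
  obtain ⟨g, hg⟩ := MonoidAlgebra.exists_leftInverse_of_injective
    (IntertwiningMap.equivLinearMapAsModule σ τ i) (LinearMap.ker_eq_bot.2 hi)
  refine ⟨(IntertwiningMap.equivLinearMapAsModule τ σ).symm g, fun u => ?_⟩
  exact LinearMap.congr_fun hg u

theorem exists_rightInverse_of_surjective (q : IntertwiningMap τ σ) (hq : Function.Surjective q) :
    ∃ i : IntertwiningMap σ τ, ∀ u, q (i u) = u := by
  obtain ⟨g, hg⟩ := IsSemisimpleModule.lifting_property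
    (IntertwiningMap.equivLinearMapAsModule τ σ q) hq LinearMap.id
  refine ⟨(IntertwiningMap.equivLinearMapAsModule σ τ).symm g, fun u => ?_⟩
  exact LinearMap.congr_fun hg u

end Maschke

section Induction

variable {k G : Type*} [Field k] [Group G]

/-- The inclusion of a subrepresentation. -/
def _root_.Subrepresentation.incl {V : Type*} [AddCommGroup V] [Module k V]
    {τ : Representation k G V} (σ : Subrepresentation τ) :
    IntertwiningMap σ.toRepresentation τ where
  toLinearMap := σ.toSubmodule.subtype
  isIntertwining' _ := rfl

/-- The representation `τ` is the direct sum of `σ₁` and `σ₂`. -/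
structure Splitting {V V₁ V₂ : Type*} [AddCommGroup V] [Module k V] [AddCommGroup V₁]
    [Module k V₁] [AddCommGroup V₂] [Module k V₂] (τ : Representation k G V)
    (σ₁ : Representation k G V₁) (σ₂ : Representation k G V₂) where
  incl₁ : IntertwiningMap σ₁ τ
  incl₂ : IntertwiningMap σ₂ τ
  proj₁ : IntertwiningMap τ σ₁
  proj₂ : IntertwiningMap τ σ₂
  proj₁_incl₁ : ∀ v, proj₁ (incl₁ v) = v
  proj₂_incl₂ : ∀ v, proj₂ (incl₂ v) = v
  proj₁_incl₂ : ∀ v, proj₁ (incl₂ v) = 0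
  proj₂_incl₁ : ∀ v, proj₂ (incl₁ v) = 0
  add_eq : ∀ v, incl₁ (proj₁ v) + incl₂ (proj₂ v) = v

/-- The complement is the kernel of the equivariant retraction given by Maschke's theorem. -/
theorem exists_splitting [Finite G] [NeZero (Nat.card G : k)] {V : Type*} [AddCommGroup V]
    [Module k V] {τ : Representation k G V} (σ : Subrepresentation τ) :
    ∃ σ' : Subrepresentation τ, Nonempty (Splitting τ σ.toRepresentation σ'.toRepresentation) := by
  obtain ⟨q, hq⟩ := exists_leftInverse_of_injective σ.incl Subtype.val_injective
  have hmem (v : V) : v - σ.incl (q v) ∈ q.ker := by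
    rw [IntertwiningMap.mem_ker, map_sub, hq, sub_self]
  refine ⟨q.ker, ⟨?_⟩⟩
  exact
    { incl₁ := σ.incl
      incl₂ := q.ker.incl
      proj₁ := q
      proj₂ :=
        { toLinearMap := LinearMap.codRestrict q.ker.toSubmodule
            (LinearMap.id - σ.incl.toLinearMap ∘ₗ q.toLinearMap) hmem
          isIntertwining' g := by
            ext v
            change τ g v - σ.incl (q (τ g v)) = τ g (v - σ.incl (q v))
            rw [map_sub, q.isIntertwining, σ.incl.isIntertwining] }
      proj₁_incl₁ := hq
      proj₂_incl₂ u := by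
        have hu : q u.1 = 0 := u.2
        refine Subtype.ext ?_
        change u.1 - σ.incl (q u.1) = u.1
        rw [hu, map_zero, sub_zero]
      proj₁_incl₂ u := u.2
      proj₂_incl₁ u := by
        refine Subtype.ext ?_
        change σ.incl u - σ.incl (q (σ.incl u)) = 0
        rw [hq, sub_self]
      add_eq v := add_sub_cancel (σ.incl (q v)) v }

/-- The linear isomorphism underlying a splitting. -/
def Splitting.linearEquiv {V V₁ V₂ : Type*} [AddCommGroup V] [Module k V] [AddCommGroup V₁]
    [Module k V₁] [AddCommGroup V₂] [Module k V₂] {τ : Representation k G V}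
    {σ₁ : Representation k G V₁} {σ₂ : Representation k G V₂} (s : Splitting τ σ₁ σ₂) :
    V ≃ₗ[k] V₁ × V₂ where
  __ := s.proj₁.toLinearMap.prod s.proj₂.toLinearMap
  invFun v := s.incl₁ v.1 + s.incl₂ v.2
  left_inv v := s.add_eq v
  right_inv v := by
    change (s.proj₁ _, s.proj₂ _) = v
    simp [s.proj₁_incl₁, s.proj₂_incl₂, s.proj₁_incl₂, s.proj₂_incl₁]

/-- Induction on dimension: a nonzero reducible representation has a proper nonzero
subrepresentation, and Maschke splits it off with both pieces smaller. This replaces explicit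
decompositions into irreducibles. -/
theorem semisimple_induction.{u} [Finite G] [NeZero (Nat.card G : k)]
    {motive : ∀ (V : Type u) [AddCommGroup V] [Module k V], Representation k G V → Prop}
    (zero : ∀ (V : Type u) [AddCommGroup V] [Module k V] (τ : Representation k G V),
      Subsingleton V → motive V τ)
    (irreducible : ∀ (V : Type u) [AddCommGroup V] [Module k V] (τ : Representation k G V),
      τ.IsIrreducible → motive V τ)
    (splitting : ∀ (V V₁ V₂ : Type u) [AddCommGroup V] [Module k V] [AddCommGroup V₁]
      [Module k V₁] [AddCommGroup V₂] [Module k V₂] (τ : Representation k G V)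
      (σ₁ : Representation k G V₁) (σ₂ : Representation k G V₂), Splitting τ σ₁ σ₂ →
      motive V₁ σ₁ → motive V₂ σ₂ → motive V τ)
    (V : Type u) [AddCommGroup V] [Module k V] [Module.Finite k V] (τ : Representation k G V) :
    motive V τ := by
  induction h : finrank k V using Nat.strong_induction_on generalizing V with
  | _ n ih =>
  subst h
  rcases subsingleton_or_nontrivial V with hV | hV
  · exact zero V τ hV
  by_cases hτ : τ.IsIrreducible
  · exact irreducible V τ hτ
  have : Nontrivial (Subrepresentation τ) := by
    refine ⟨⊥, ⊤, fun h => ?_⟩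
    have := congrArg Subrepresentation.toSubmodule h
    exact bot_ne_top (α := Submodule k V) this
  obtain ⟨σ, hσ⟩ : ∃ σ : Subrepresentation τ, ¬(σ = ⊥ ∨ σ = ⊤) := by
    by_contra! h
    exact hτ ⟨fun σ => h σ⟩
  push Not at hσ
  obtain ⟨σ', ⟨s⟩⟩ := exists_splitting σ
  have hne : σ.toSubmodule ≠ ⊤ := fun h => hσ.2 (Subrepresentation.toSubmodule_injective h)
  have hne' : σ.toSubmodule ≠ ⊥ := fun h => hσ.1 (Subrepresentation.toSubmodule_injective h)
  have hadd : finrank k V = finrank k σ.toSubmodule + finrank k σ'.toSubmodule := by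
    rw [← Module.finrank_prod]
    exact s.linearEquiv.finrank_eq
  have hlt := Submodule.finrank_lt hne
  have hpos : finrank k σ.toSubmodule ≠ 0 := fun h => hne' (Submodule.finrank_eq_zero.1 h)
  exact splitting _ _ _ τ _ _ s (ih _ hlt _ _ rfl) (ih _ (by omega) _ _ rfl)

end Induction

/-! ### Coordinates -/

section Coordinates

variable {k G V : Type*} [Field k] [Group G] [AddCommGroup V] [Module k V]

/-- The representation transported to the coordinate space. -/
def coordinates [Module.Finite k V] (τ : Representation k G V) :
    Representation k G (Fin (finrank k V) → k) :=
  ((finBasis k V).equivFun.conjRingEquiv : _ →* _).comp τ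

/-- A representation is isomorphic to its transport to the coordinate space. -/
def equivCoordinates [Module.Finite k V] (τ : Representation k G V) :
    τ.Equiv τ.coordinates :=
  .mk (finBasis k V).equivFun fun g => by
    ext v
    simp [coordinates]

theorem Equiv.isIrreducible {U : Type*} [AddCommGroup U] [Module k U] {σ : Representation k G U}
    {τ : Representation k G V} (e : σ.Equiv τ) (h : σ.IsIrreducible) : τ.IsIrreducible := by
  rw [irreducible_iff_isSimpleModule_asModule] at h ⊢
  exact (LinearEquiv.ofBijective (IntertwiningMap.equivLinearMapAsModule τ σ
    e.symm.toIntertwiningMap) e.symm.toLinearEquiv.bijective).isSimpleModule_iff.2 h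

theorem IsIrreducible.nontrivial {τ : Representation k G V} (h : τ.IsIrreducible) :
    Nontrivial V := by
  rw [irreducible_iff_isSimpleModule_asModule] at h
  exact IsSimpleModule.nontrivial k[G] τ.asModule

end Coordinates

end Representation

namespace Representation

open Module

/-! ### Finiteness of the set of irreducible representations -/

section Irreducibles

variable {k G : Type*} [Field k] [Group G]

/-- A nonzero vector v defines a map k[G] → V hitting v; being nonzero with irreducible target, it
is onto. -/
theorem IsIrreducible.exists_surjective_leftRegular {V : Type*} [AddCommGroup V] [Module k V]
    {τ : Representation k G V} (h : τ.IsIrreducible) :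
    ∃ f : IntertwiningMap (leftRegular k G) τ, Function.Surjective f := by
  have := h.nontrivial
  obtain ⟨v, hv⟩ := exists_ne (0 : V)
  refine ⟨(leftRegularMapEquiv τ).symm v, ?_⟩
  refine (IsIrreducible.surjective_or_eq_zero _).resolve_right fun h0 => hv ?_
  rw [← (leftRegularMapEquiv τ).apply_symm_apply v, h0, map_zero]

theorem IsIrreducible.moduleFinite [Finite G] {V : Type*} [AddCommGroup V] [Module k V]
    {τ : Representation k G V} (h : τ.IsIrreducible) : Module.Finite k V := by
  obtain ⟨f, hf⟩ := h.exists_surjective_leftRegular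
  have : Module.Finite k (MonoidAlgebra k G) := inferInstance
  exact Module.Finite.of_surjective f.toLinearMap hf

/-- A nonzero map from a direct sum is nonzero on some summand, and Schur's lemma settles the
irreducible case. The family may contain repetitions. Models on k^d keep it independent of the
universe of V. -/
theorem exists_finite_irreducibles_of_rep.{u} [Finite G] [NeZero (Nat.card G : k)]
    (V : Type u) [AddCommGroup V] [Module k V] [Module.Finite k V] (τ : Representation k G V) :
    ∃ (ι : Type) (_ : Finite ι) (S : ι → Σ d : ℕ, Representation k G (Fin d → k)),
      (∀ i, (S i).2.IsIrreducible) ∧ ∀ (d' : ℕ) (σ : Representation k G (Fin d' → k)),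
        σ.IsIrreducible → (∃ f : IntertwiningMap τ σ, f ≠ 0) →
          ∃ i, Nonempty (σ.Equiv (S i).2) := by
  induction V, τ using semisimple_induction with
  | zero V τ h =>
    refine ⟨Empty, inferInstance, Empty.elim, fun i => i.elim, fun d' σ _ ⟨f, hf⟩ => (hf ?_).elim⟩
    ext v : 2
    rw [Subsingleton.elim v 0, map_zero, map_zero]
  | irreducible V τ h =>
    have := h.moduleFinite
    refine ⟨Unit, inferInstance, fun _ => ⟨finrank k V, τ.coordinates⟩,
      fun _ => τ.equivCoordinates.isIrreducible h, fun d' σ hσ ⟨f, hf⟩ => ⟨(), ⟨?_⟩⟩⟩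
    exact (IntertwiningMap.ofBijective f
      ((IsIrreducible.bijective_or_eq_zero f).resolve_right hf)).symm.trans τ.equivCoordinates
  | splitting V V₁ V₂ τ σ₁ σ₂ s h₁ h₂ =>
    obtain ⟨ι₁, _, S₁, hi₁, h₁⟩ := h₁
    obtain ⟨ι₂, _, S₂, hi₂, h₂⟩ := h₂
    refine ⟨ι₁ ⊕ ι₂, inferInstance, Sum.elim S₁ S₂, Sum.forall.2 ⟨hi₁, hi₂⟩, ?_⟩
    rintro d' σ hσ ⟨f, hf⟩
    by_cases hf₁ : f.comp s.incl₁ = 0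
    · by_cases hf₂ : f.comp s.incl₂ = 0
      · refine (hf ?_).elim
        ext v : 2
        have e₁ : f (s.incl₁ (s.proj₁ v)) = 0 := DFunLike.congr_fun hf₁ (s.proj₁ v)
        have e₂ : f (s.incl₂ (s.proj₂ v)) = 0 := DFunLike.congr_fun hf₂ (s.proj₂ v)
        change f v = 0
        rw [← s.add_eq v, map_add, e₁, e₂, add_zero]
      · obtain ⟨i, hi⟩ := h₂ d' σ hσ ⟨_, hf₂⟩
        exact ⟨Sum.inr i, hi⟩
    · obtain ⟨i, hi⟩ := h₁ d' σ hσ ⟨_, hf₁⟩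
      exact ⟨Sum.inl i, hi⟩

variable (k G) in
-- Every irreducible is a quotient of the left regular representation, which is finite dimensional.
theorem exists_finite_irreducibles [Finite G] [NeZero (Nat.card G : k)] :
    ∃ (ι : Type) (_ : Finite ι) (S : ι → Σ d : ℕ, Representation k G (Fin d → k)),
      (∀ i, (S i).2.IsIrreducible) ∧ ∀ (V : Type*) [AddCommGroup V] [Module k V]
        (σ : Representation k G V), σ.IsIrreducible → ∃ i, Nonempty (σ.Equiv (S i).2) := by
  obtain ⟨ι, _, S, hi, h⟩ := exists_finite_irreducibles_of_rep _ (leftRegular k G)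
  refine ⟨ι, inferInstance, S, hi, fun V _ _ σ hσ => ?_⟩
  have := hσ.moduleFinite
  have hσ' := σ.equivCoordinates.isIrreducible hσ
  obtain ⟨f, hf⟩ := hσ'.exists_surjective_leftRegular
  obtain ⟨i, ⟨e⟩⟩ := h _ _ hσ' ⟨f, by
    rintro rfl
    have := hσ'.nontrivial
    obtain ⟨v, hv⟩ := exists_ne (0 : Fin (finrank k V) → k)
    obtain ⟨x, hx⟩ := hf v
    exact hv hx.symm⟩
  exact ⟨i, ⟨σ.equivCoordinates.trans e⟩⟩

end Irreducibles

/-! ### Frobenius twists of representations -/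

section Twist

variable {k G U V : Type*} [Field k] [Group G] [AddCommGroup U] [Module k U]
  [AddCommGroup V] [Module k V] (p : ℕ) [ExpChar k p] [PerfectField k]
  {σ : Representation k G U} {τ : Representation k G V}

/-- The twist of an intertwining map. -/
def IntertwiningMap.twist (i : IntertwiningMap σ τ) (f : ℤ) :
    IntertwiningMap (σ.frobeniusTwist p f) (τ.frobeniusTwist p f) where
  toFun u := Pullback.of _ _ (i ((Pullback.of _ U).symm u))
  map_add' u v := by rw [map_add, map_add, map_add]
  map_smul' a u := i.toLinearMap.map_smul _ _
  isIntertwining' g := by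
    ext u
    exact IntertwiningMap.isIntertwining _ _ i g _

/-- The twist of an isomorphism. -/
def Equiv.twist (i : σ.Equiv τ) (f : ℤ) : (σ.frobeniusTwist p f).Equiv (τ.frobeniusTwist p f) :=
  IntertwiningMap.ofBijective (i.toIntertwiningMap.twist p f) i.toLinearEquiv.bijective

variable (σ) in
/-- Twists add up. -/
def twistTwist (a b : ℤ) :
    ((σ.frobeniusTwist p a).frobeniusTwist p b).Equiv (σ.frobeniusTwist p (a + b)) :=
  .mk
    { toFun u := Pullback.of _ U ((Pullback.of _ U).symm ((Pullback.of _ _).symm u))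
      map_add' u v := rfl
      map_smul' c u := by
        obtain ⟨u, rfl⟩ := (Pullback.of _ _).surjective u
        obtain ⟨u, rfl⟩ := (Pullback.of _ U).surjective u
        change Pullback.of _ U
            ((((frobeniusEquiv k p : RingAut k) ^ (-a) * (frobeniusEquiv k p : RingAut k) ^ (-b)) :
              RingAut k) c • u) =
          Pullback.of _ U (((frobeniusEquiv k p : RingAut k) ^ (-(a + b)) : RingAut k) c • u)
        rw [← zpow_add, neg_add]
      invFun u := Pullback.of _ _ (Pullback.of _ U ((Pullback.of _ U).symm u))
      left_inv _ := rfl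
      right_inv _ := rfl }
    fun g => rfl

variable (σ) in
/-- The trivial twist. -/
def twistZero : (σ.frobeniusTwist p 0).Equiv σ :=
  .mk
    { toFun u := (Pullback.of _ U).symm u
      map_add' u v := rfl
      map_smul' c u := by
        obtain ⟨u, rfl⟩ := (Pullback.of _ _).surjective u
        change ((frobeniusEquiv k p : RingAut k) ^ (-0 : ℤ)) c • u = c • u
        rw [neg_zero, zpow_zero]
        rfl
      invFun u := Pullback.of _ U u
      left_inv _ := rfl
      right_inv _ := rfl }
    fun g => rfl

/-- The twist and the original have the same subrepresentations as subgroups, because scalars are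
twisted by an automorphism of k. -/
theorem IsIrreducible.twist (h : σ.IsIrreducible) (f : ℤ) :
    (σ.frobeniusTwist p f).IsIrreducible := by
  let φ : RingAut k := (frobeniusEquiv k p : RingAut k) ^ (-f)
  let e : Subrepresentation σ ≃o Subrepresentation (σ.frobeniusTwist p f) :=
    { toFun s :=
        { toSubmodule.carrier := {u | (Pullback.of _ U).symm u ∈ s.toSubmodule}
          toSubmodule.add_mem' := s.toSubmodule.add_mem
          toSubmodule.zero_mem' := s.toSubmodule.zero_mem
          toSubmodule.smul_mem' c u hu := s.toSubmodule.smul_mem (φ c) hu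
          apply_mem_toSubmodule g u hu := s.apply_mem_toSubmodule g hu }
      invFun s :=
        { toSubmodule.carrier := {u | Pullback.of _ U u ∈ s.toSubmodule}
          toSubmodule.add_mem' := s.toSubmodule.add_mem
          toSubmodule.zero_mem' := s.toSubmodule.zero_mem
          toSubmodule.smul_mem' c u hu := by
            have := s.toSubmodule.smul_mem (φ⁻¹ c) hu
            change Pullback.of _ U ((φ * φ⁻¹) c • u) ∈ s.toSubmodule at this
            rwa [mul_inv_cancel] at this
          apply_mem_toSubmodule g u hu := s.apply_mem_toSubmodule g hu }
      left_inv s := rfl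
      right_inv s := rfl
      map_rel_iff' := Iff.rfl }
  exact e.isSimpleOrder_iff.1 h

end Twist

end Representation

namespace Representation

open Module SymmetricAlgebra

/-! ### Functoriality of the module of covariants -/

section Functoriality

variable {k G W U V : Type*} [Field k] [Group G] [AddCommGroup W] [Module k W]
  [AddCommGroup U] [Module k U] [AddCommGroup V] [Module k V] (ρ : Representation k G W)
  {σ : Representation k G U} {τ : Representation k G V}

/-- The map of modules of covariants induced by an intertwining map. -/
def covariantsMap (f : IntertwiningMap σ τ) :
    ρ.covariants σ →ₗ[ρ.symInvariants] ρ.covariants τ where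
  toFun x := ⟨f.toLinearMap.lTensor _ x.1, fun g => by
    conv_rhs => rw [← x.2 g]
    change (TensorProduct.map _ _) _ = (f.toLinearMap.lTensor _) (TensorProduct.map _ _ _)
    rw [LinearMap.lTensor, ← LinearMap.comp_apply, ← LinearMap.comp_apply,
      ← TensorProduct.map_comp, ← TensorProduct.map_comp, f.isIntertwining', LinearMap.comp_id,
      LinearMap.id_comp]⟩
  map_add' x y := Subtype.ext (map_add _ x.1 y.1)
  map_smul' r x := Subtype.ext
    ((TensorProduct.AlgebraTensorModule.lTensor _ (SymmetricAlgebra k W) f.toLinearMap).map_smul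
      r.1 x.1)

theorem covariantsMap_comp {U' : Type*} [AddCommGroup U'] [Module k U']
    {υ : Representation k G U'} (f : IntertwiningMap τ υ) (g : IntertwiningMap σ τ)
    (x : ρ.covariants σ) : ρ.covariantsMap (f.comp g) x = ρ.covariantsMap f (ρ.covariantsMap g x) :=
  Subtype.ext (LinearMap.lTensor_comp_apply _ _ _ _)

theorem covariantsMap_id (x : ρ.covariants σ) : ρ.covariantsMap (.id σ) x = x :=
  Subtype.ext (LinearMap.lTensor_id_apply _ _ _)

theorem covariantsMap_zero (x : ρ.covariants σ) :
    ρ.covariantsMap (0 : IntertwiningMap σ τ) x = 0 :=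
  Subtype.ext (by
    change (0 : U →ₗ[k] V).lTensor _ x.1 = 0
    rw [LinearMap.lTensor_zero, LinearMap.zero_apply])

theorem covariantsMap_add (f g : IntertwiningMap σ τ) (x : ρ.covariants σ) :
    ρ.covariantsMap (f + g) x = ρ.covariantsMap f x + ρ.covariantsMap g x :=
  Subtype.ext (by
    change (f.toLinearMap + g.toLinearMap).lTensor _ x.1 = _
    rw [LinearMap.lTensor_add]
    rfl)

theorem covariantsMap_leftInverse {f : IntertwiningMap σ τ} {g : IntertwiningMap τ σ}
    (h : ∀ u, g (f u) = u) (x : ρ.covariants σ) :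
    ρ.covariantsMap g (ρ.covariantsMap f x) = x := by
  rw [← covariantsMap_comp]
  convert ρ.covariantsMap_id x
  ext u
  exact h u

theorem covariantsMap_comp_eq_zero {U' : Type*} [AddCommGroup U'] [Module k U']
    {υ : Representation k G U'} {f : IntertwiningMap τ υ} {g : IntertwiningMap σ τ}
    (h : ∀ u, f (g u) = 0) (x : ρ.covariants σ) :
    ρ.covariantsMap f (ρ.covariantsMap g x) = 0 := by
  rw [← covariantsMap_comp]
  convert ρ.covariantsMap_zero x
  ext u
  exact h u

/-- Isomorphic representations have isomorphic modules of covariants. -/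
def covariantsEquiv (e : σ.Equiv τ) : ρ.covariants σ ≃ₗ[ρ.symInvariants] ρ.covariants τ where
  __ := ρ.covariantsMap e.toIntertwiningMap
  invFun := ρ.covariantsMap e.symm.toIntertwiningMap
  left_inv := ρ.covariantsMap_leftInverse fun u => e.symm_apply_apply u
  right_inv := ρ.covariantsMap_leftInverse fun u => e.apply_symm_apply u

/-- The module of covariants of a direct sum. -/
def covariantsSplitting {V₁ V₂ : Type*} [AddCommGroup V₁] [Module k V₁] [AddCommGroup V₂]
    [Module k V₂] {σ₁ : Representation k G V₁} {σ₂ : Representation k G V₂}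
    (s : Splitting τ σ₁ σ₂) :
    ρ.covariants τ ≃ₗ[ρ.symInvariants] ρ.covariants σ₁ × ρ.covariants σ₂ where
  __ := (ρ.covariantsMap s.proj₁).prod (ρ.covariantsMap s.proj₂)
  invFun x := ρ.covariantsMap s.incl₁ x.1 + ρ.covariantsMap s.incl₂ x.2
  left_inv x := by
    change ρ.covariantsMap s.incl₁ (ρ.covariantsMap s.proj₁ x) +
      ρ.covariantsMap s.incl₂ (ρ.covariantsMap s.proj₂ x) = x
    rw [← covariantsMap_comp, ← covariantsMap_comp, ← covariantsMap_add]
    convert ρ.covariantsMap_id x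
    ext v
    exact s.add_eq v
  right_inv x := by
    change (ρ.covariantsMap s.proj₁ _, ρ.covariantsMap s.proj₂ _) = x
    rw [map_add, map_add, ρ.covariantsMap_leftInverse s.proj₁_incl₁,
      ρ.covariantsMap_leftInverse s.proj₂_incl₂, ρ.covariantsMap_comp_eq_zero s.proj₁_incl₂,
      ρ.covariantsMap_comp_eq_zero s.proj₂_incl₁, add_zero, zero_add]

theorem isDirectSummandOf_covariants [Finite G] [NeZero (Nat.card G : k)] (h : σ.OccursIn τ) :
    IsDirectSummandOf ρ.symInvariants (ρ.covariants σ) (ρ.covariants τ) := by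
  obtain ⟨i, hi⟩ := h
  obtain ⟨q, hq⟩ := exists_leftInverse_of_injective i hi
  exact ⟨ρ.covariantsMap i, ρ.covariantsMap q,
    LinearMap.ext fun x => ρ.covariantsMap_leftInverse hq x⟩

end Functoriality

/-- Finite powers of a family of modules, with exponents added. -/
def _root_.LinearEquiv.piFinAdd {R ι : Type*} [Semiring R] (A : ι → Type*) [∀ i, AddCommMonoid (A i)]
    [∀ i, Module R (A i)] (m n : ι → ℕ) :
    (((i : ι) → Fin (m i) → A i) × ((i : ι) → Fin (n i) → A i)) ≃ₗ[R]
      ((i : ι) → Fin (m i + n i) → A i) where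
  toFun x i := Fin.append (x.1 i) (x.2 i)
  map_add' x y := by
    ext i j
    refine j.addCases (fun j => ?_) fun j => ?_ <;> simp
  map_smul' r x := by
    ext i j
    refine j.addCases (fun j => ?_) fun j => ?_ <;> simp
  invFun x := (fun i j => x i (Fin.castAdd _ j), fun i j => x i (Fin.natAdd _ j))
  left_inv x := by ext <;> simp
  right_inv x := by
    ext i j
    refine j.addCases (fun j => ?_) fun j => ?_ <;> simp

/-- A direct sum of two direct sums of finite powers of a family of modules. -/
def _root_.LinearEquiv.piFinTrans {R ι M M₁ M₂ : Type*} [Semiring R] (A : ι → Type*)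
    [∀ i, AddCommMonoid (A i)] [∀ i, Module R (A i)] [AddCommMonoid M] [Module R M]
    [AddCommMonoid M₁] [Module R M₁] [AddCommMonoid M₂] [Module R M₂] (m n : ι → ℕ)
    (e : M ≃ₗ[R] M₁ × M₂) (e₁ : M₁ ≃ₗ[R] ((i : ι) → Fin (m i) → A i))
    (e₂ : M₂ ≃ₗ[R] ((i : ι) → Fin (n i) → A i)) :
    M ≃ₗ[R] ((i : ι) → Fin (m i + n i) → A i) :=
  e.trans ((e₁.prodCongr e₂).trans (LinearEquiv.piFinAdd A m n))

/-- Covariants commute with direct sums, so multiplicities add along a splitting. The hypothesis on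
irreducibles passes to summands because they embed in τ. -/
theorem exists_covariants_equiv.{u} {k G W : Type*} [Field k] [Group G] [Finite G]
    [NeZero (Nat.card G : k)] [AddCommGroup W] [Module k W] (ρ : Representation k G W) {n : ℕ}
    {d : Fin n → ℕ} (σ : ∀ i, Representation k G (Fin (d i) → k))
    (V : Type u) [AddCommGroup V] [Module k V] [Module.Finite k V] (τ : Representation k G V)
    (hτ : ∀ (U : Type u) [AddCommGroup U] [Module k U] (υ : Representation k G U),
      υ.IsIrreducible → υ.OccursIn τ → ∃ i, Nonempty (υ.Equiv (σ i))) :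
    ∃ m : Fin n → ℕ, Nonempty (ρ.covariants τ ≃ₗ[ρ.symInvariants]
      ((i : Fin n) → Fin (m i) → ρ.covariants (σ i))) := by
  revert hτ
  induction V, τ using semisimple_induction with
  | zero V τ h =>
    intro _
    have : Subsingleton (ρ.covariants τ) := by
      refine subsingleton_of_forall_eq 0 fun x => ?_
      rw [← ρ.covariantsMap_id x]
      convert ρ.covariantsMap_zero x
      ext v : 2
      exact Subsingleton.elim _ _
    exact ⟨fun _ => 0, ⟨0⟩⟩
  | irreducible V τ h =>
    intro hτ
    obtain ⟨i, ⟨e⟩⟩ := hτ V τ h ⟨.id τ, Function.injective_id⟩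
    -- Multiplicity one at i and zero elsewhere; the other factors are functions on an empty type.
    let f : ((j : Fin n) → Fin (if j = i then 1 else 0) → ρ.covariants (σ j)) →ₗ[ρ.symInvariants]
        ρ.covariants (σ i) :=
      LinearMap.proj (⟨0, by simp⟩ : Fin (if i = i then 1 else 0)) ∘ₗ LinearMap.proj i
    refine ⟨_, ⟨(ρ.covariantsEquiv e).trans (LinearEquiv.ofBijective f ⟨?_, ?_⟩).symm⟩⟩
    · intro x y hxy
      ext1 j
      by_cases hj : j = i
      · subst hj
        ext1 t
        have : t = ⟨0, by simp⟩ := by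
          apply Fin.ext
          have := t.2
          simp at this
          exact this
        rw [this]
        exact hxy
      · ext1 t
        have := t.2
        simp [hj] at this
    · exact fun y => ⟨Pi.single i fun _ => y, by simp [f]⟩
  | splitting V V₁ V₂ τ σ₁ σ₂ s h₁ h₂ =>
    intro hτ
    obtain ⟨m₁, ⟨e₁⟩⟩ := h₁ fun U _ _ υ hυ ⟨i, hi⟩ => hτ U υ hυ ⟨s.incl₁.comp i,
      (Function.LeftInverse.injective s.proj₁_incl₁).comp hi⟩
    obtain ⟨m₂, ⟨e₂⟩⟩ := h₂ fun U _ _ υ hυ ⟨i, hi⟩ => hτ U υ hυ ⟨s.incl₂.comp i,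
      (Function.LeftInverse.injective s.proj₂_incl₂).comp hi⟩
    exact ⟨_, ⟨LinearEquiv.piFinTrans (fun i => ρ.covariants (σ i)) m₁ m₂
      (ρ.covariantsSplitting s) e₁ e₂⟩⟩

end Representation

/-! ### Irreducibles in twists of symmetric powers and of truncations -/

namespace Representation

open Module SymmetricAlgebra

section Occurrence

variable {k G W : Type*} [Field k] [Group G] [AddCommGroup W] [Module k W]
  (ρ : Representation k G W)

/-- The map from a homogeneous component to the truncated symmetric algebra. -/
def symPowToTruncated (l q : ℕ) : IntertwiningMap (ρ.symPow l) (ρ.symTruncated q) where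
  toLinearMap := truncatedMk k W q ∘ₗ Submodule.subtype _
  isIntertwining' _ := rfl

variable (p : ℕ) [ExpChar k p]

/-- A monomial of degree l < q has no exponent reaching q, so S^l W meets S₊^[q] trivially. -/
theorem symPowToTruncated_injective {l e : ℕ} (hl : l < p ^ e) :
    Function.Injective (ρ.symPowToTruncated l (p ^ e)) := by
  rw [injective_iff_map_eq_zero]
  rintro ⟨s, hs⟩ h
  replace h : s ∈ (symPosFrobeniusPower k W (p ^ e)).restrictScalars k :=
    (Submodule.Quotient.mk_eq_zero _).1 h
  let b := Basis.ofVectorSpace k W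
  rw [symPosFrobeniusPower_eq_span b, Basis.mem_span_image] at h
  rw [mem_symPow_iff b] at hs
  refine Subtype.ext ((LinearEquiv.map_eq_zero_iff b.symmetricAlgebra.repr).1 ?_)
  by_contra hne
  obtain ⟨m, hm⟩ := Finsupp.ne_iff.1 hne
  obtain ⟨i, hi⟩ := h (Finsupp.mem_support_iff.2 hm)
  have := Finsupp.le_degree i m
  have := hs m hm
  omega

variable [PerfectField k] [Finite G] [NeZero (Nat.card G : k)]
  {U : Type*} [AddCommGroup U] [Module k U] {υ : Representation k G U}

/-- The images of the S^l W span the truncation, so an equivariant projection onto υ is nonzero on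
one of them. It is then onto υ there, and splits. -/
theorem occursIn_symPow_of_occursIn_symTruncated (hυ : υ.IsIrreducible) {e : ℕ}
    (h : υ.OccursIn ((ρ.symTruncated (p ^ e)).frobeniusTwist p (-(e : ℤ)))) :
    ∃ l, υ.OccursIn ((ρ.symPow l).frobeniusTwist p (-(e : ℤ))) := by
  obtain ⟨i, hi⟩ := h
  obtain ⟨q, hq⟩ := exists_leftInverse_of_injective i hi
  let j (l : ℕ) := (ρ.symPowToTruncated l (p ^ e)).twist p (-(e : ℤ))
  obtain ⟨l, hl⟩ : ∃ l, q.comp (j l) ≠ 0 := by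
    by_contra! h0
    have hzero (s : SymmetricAlgebra k W) :
        q (Pullback.of _ _ (truncatedMk k W (p ^ e) s)) = 0 := by
      have hs : s ∈ ⨆ l, _root_.symPow k W l := by rw [iSup_symPow]; trivial
      induction hs using Submodule.iSup_induction' with
      | mem l s hs => exact DFunLike.congr_fun (h0 l) (Pullback.of _ _ ⟨s, hs⟩)
      | zero => rw [map_zero, map_zero, map_zero]
      | add s t _ _ hs ht => rw [map_add, map_add, map_add, hs, ht, add_zero]
    have := hυ.nontrivial
    obtain ⟨u, hu⟩ := exists_ne (0 : U)
    obtain ⟨x, hx⟩ := (Pullback.of _ _).surjective (i u)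
    obtain ⟨s, rfl⟩ := Submodule.mkQ_surjective _ x
    refine hu ?_
    rw [← hq u, ← hx]
    exact hzero s
  obtain ⟨r, hr⟩ := exists_rightInverse_of_surjective (q.comp (j l))
    ((IsIrreducible.surjective_or_eq_zero _).resolve_right hl)
  exact ⟨l, r, Function.LeftInverse.injective hr⟩

/-- Pigeonhole: infinitely many of the twists υ^(-j) lie in one isomorphism class. Two of them with
indices more than n apart, twisted back by the smaller index, give the claim. -/
theorem exists_equiv_twist (hυ : υ.IsIrreducible) (n : ℕ) :
    ∃ D : ℕ, n ≤ D ∧ Nonempty (υ.Equiv (υ.frobeniusTwist p (-(D : ℤ)))) := by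
  obtain ⟨ι, _, S, -, hS⟩ := exists_finite_irreducibles k G
  choose c hc using fun j : ℕ => hS _ _ (hυ.twist p (-(j : ℤ)))
  obtain ⟨i, hi⟩ := Finite.exists_infinite_fiber c
  have hinf : (c ⁻¹' {i}).Infinite := Set.infinite_coe_iff.1 hi
  obtain ⟨j₀, hj₀⟩ := hinf.nonempty
  obtain ⟨j, hj, hlt⟩ := hinf.exists_gt (j₀ + n)
  obtain ⟨e₀⟩ := hc j₀
  obtain ⟨e₁⟩ := hc j
  rw [show c j₀ = i from hj₀] at e₀
  rw [show c j = i from hj] at e₁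
  have e₂ := (twistTwist p υ (-(j₀ : ℤ)) j₀).symm.trans
    (((e₀.trans e₁.symm).twist p j₀).trans (twistTwist p υ (-(j : ℤ)) j₀))
  rw [show -(j₀ : ℤ) + j₀ = 0 by ring,
    show -(j : ℤ) + j₀ = -((j - j₀ : ℕ) : ℤ) by rw [Nat.cast_sub (by omega)]; ring] at e₂
  exact ⟨j - j₀, by omega, ⟨(twistZero p υ).symm.trans e₂⟩⟩

/-- The twist f is arbitrary, while the truncation needs twist -e together with l < p^e. Replacing υ
by the isomorphic υ^(-D), D large, changes f into f - D without changing l. -/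
theorem exists_occursIn_symTruncated (hp : 1 < p) (hυ : υ.IsIrreducible) {l : ℕ} {f : ℤ}
    (h : υ.OccursIn ((ρ.symPow l).frobeniusTwist p f)) :
    ∃ e : ℕ, υ.OccursIn ((ρ.symTruncated (p ^ e)).frobeniusTwist p (-(e : ℤ))) := by
  obtain ⟨i, hi⟩ := h
  obtain ⟨D, hD, ⟨ε⟩⟩ := exists_equiv_twist p hυ (f.natAbs + l)
  -- From D ≥ |f| + l the integer e = D - f is at least l, hence l < p^e.
  obtain ⟨e, he⟩ : ∃ e : ℕ, f + -(D : ℤ) = -(e : ℤ) := ⟨(D - f).toNat, by omega⟩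
  let ε' := twistTwist p (ρ.symPow l) f (-(D : ℤ))
  rw [he] at ε'
  have hle : l < p ^ e := lt_of_le_of_lt (by omega) (Nat.lt_pow_self hp)
  refine ⟨e, ((ρ.symPowToTruncated l (p ^ e)).twist p (-(e : ℤ))).comp
    (ε'.toIntertwiningMap.comp ((i.twist p (-(D : ℤ))).comp ε.toIntertwiningMap)), ?_⟩
  have h₁ : Function.Injective ((ρ.symPowToTruncated l (p ^ e)).twist p (-(e : ℤ))) :=
    ρ.symPowToTruncated_injective p hle
  have h₂ : Function.Injective (i.twist p (-(D : ℤ))) := hi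
  exact h₁.comp (ε'.toLinearEquiv.injective.comp (h₂.comp ε.toLinearEquiv.injective))

end Occurrence

theorem OccursIn.congr {k G U V T : Type*} [Field k] [Group G] [AddCommGroup U] [Module k U]
    [AddCommGroup V] [Module k V] [AddCommGroup T] [Module k T] {σ : Representation k G U}
    {σ' : Representation k G V} {τ : Representation k G T} (h : σ.OccursIn τ) (e : σ'.Equiv σ) :
    σ'.OccursIn τ := by
  obtain ⟨i, hi⟩ := h
  exact ⟨i.comp e.toIntertwiningMap, hi.comp e.toLinearEquiv.injective⟩

theorem _root_.IsDirectSummandOf.congr {R M N N' : Type*} [Ring R] [AddCommGroup M] [Module R M]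
    [AddCommGroup N] [Module R N] [AddCommGroup N'] [Module R N'] (h : IsDirectSummandOf R M N)
    (e : N ≃ₗ[R] N') : IsDirectSummandOf R M N' := by
  obtain ⟨i, q, h⟩ := h
  refine ⟨e.toLinearMap ∘ₗ i, q ∘ₗ e.symm.toLinearMap, ?_⟩
  rw [← h]
  ext x
  simp

/-- A list without repetitions, up to isomorphism, of the irreducible representations with a
property invariant under isomorphism. -/
theorem exists_list_irreducibles {k G : Type*} [Field k] [Group G] [Finite G]
    [NeZero (Nat.card G : k)] (P : ∀ d : ℕ, Representation k G (Fin d → k) → Prop)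
    (hP : ∀ d d' (σ : Representation k G (Fin d → k)) (σ' : Representation k G (Fin d' → k)),
      Nonempty (σ.Equiv σ') → P d σ → P d' σ') :
    ∃ (n : ℕ) (d : Fin n → ℕ) (σ : ∀ i, Representation k G (Fin (d i) → k)),
      (∀ i, (σ i).IsIrreducible) ∧ (∀ i, P _ (σ i)) ∧
      (∀ i j, Nonempty ((σ i).Equiv (σ j)) → i = j) ∧
      ∀ (d' : ℕ) (τ : Representation k G (Fin d' → k)), τ.IsIrreducible → P d' τ →
        ∃ i, Nonempty (τ.Equiv (σ i)) := by
  obtain ⟨ι, _, S, hirr, hS⟩ := exists_finite_irreducibles k G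
  let A := {i : ι // P _ (S i).2}
  let r : Setoid A :=
    { r := fun i j => Nonempty ((S i.1).2.Equiv (S j.1).2)
      iseqv := ⟨fun _ => ⟨.refl _⟩, fun ⟨e⟩ => ⟨e.symm⟩, fun ⟨e⟩ ⟨e'⟩ => ⟨e.trans e'⟩⟩ }
  obtain ⟨n, ⟨ε⟩⟩ := Finite.exists_equiv_fin (Quotient r)
  let o (i : Fin n) : A := (ε.symm i).out
  refine ⟨n, fun i => (S (o i).1).1, fun i => (S (o i).1).2, fun i => hirr _, fun i => (o i).2,
    fun i j h => ?_, fun d' τ hτ h => ?_⟩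
  · have : Quotient.mk r (o i) = Quotient.mk r (o j) := Quotient.sound h
    simpa [o] using this
  · obtain ⟨i, e⟩ := hS _ τ hτ
    let a : A := ⟨i, hP _ _ _ _ e h⟩
    obtain ⟨e⟩ := e
    obtain ⟨e'⟩ : Nonempty ((S (o (ε ⟦a⟧)).1).2.Equiv (S a.1).2) := by
      refine Quotient.exact (s := r) ?_
      simp [o]
    exact ⟨ε ⟦a⟧, ⟨e.trans e'.symm⟩⟩

theorem exists_list_covariants.{u} {k G W : Type*} [Field k] [Group G] [Finite G]
    [AddCommGroup W] [Module k W] [Module.Finite k W] (ρ : Representation k G W)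
    (p : ℕ) [ExpChar k p] [PerfectField k] (hp : 1 < p) (hG : (Nat.card G : k) ≠ 0) :
    ∃ (n : ℕ) (d : Fin n → ℕ) (σ : ∀ i, Representation k G (Fin (d i) → k)),
      (∀ i, (σ i).IsIrreducible) ∧
      (∀ i, ∃ (l : ℕ) (f : ℤ), (σ i).OccursIn ((ρ.symPow l).frobeniusTwist p f)) ∧
      (∀ i j, Nonempty ((σ i).Equiv (σ j)) → i = j) ∧
      (∀ (V : Type u) [AddCommGroup V] [Module k V] (τ : Representation k G V),
        τ.IsIrreducible →
        (∃ (l : ℕ) (f : ℤ), τ.OccursIn ((ρ.symPow l).frobeniusTwist p f)) →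
        ∃ i, Nonempty (τ.Equiv (σ i))) ∧
      (∀ e : ℕ, ∃ m : Fin n → ℕ,
        Nonempty (FrobeniusModule p ρ.symInvariants e ρ.symInvariants ≃ₗ[ρ.symInvariants]
          ((i : Fin n) → Fin (m i) → ρ.covariants (σ i)))) ∧
      (∀ i, ∃ e : ℕ, IsDirectSummandOf ρ.symInvariants (ρ.covariants (σ i))
        (FrobeniusModule p ρ.symInvariants e ρ.symInvariants)) := by
  have : NeZero (Nat.card G : k) := ⟨hG⟩
  obtain ⟨n, d, σ, hirr, hocc, hinj, hall⟩ := exists_list_irreducibles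
    (fun d' (σ : Representation k G (Fin d' → k)) =>
      ∃ (l : ℕ) (f : ℤ), σ.OccursIn ((ρ.symPow l).frobeniusTwist p f))
    (fun _ _ _ _ ⟨e⟩ ⟨l, f, h⟩ => ⟨l, f, h.congr e.symm⟩)
  refine ⟨n, d, σ, hirr, hocc, hinj, fun V _ _ τ hτ ⟨l, f, h⟩ => ?_, fun e => ?_, fun i => ?_⟩
  · have := hτ.moduleFinite
    obtain ⟨i, ⟨e⟩⟩ := hall _ τ.coordinates (τ.equivCoordinates.isIrreducible hτ)
      ⟨l, f, h.congr τ.equivCoordinates.symm⟩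
    exact ⟨i, ⟨τ.equivCoordinates.trans e⟩⟩
  · obtain ⟨ε⟩ := ρ.nonempty_frobeniusModule_equiv_covariants (p := p) (e := e) hG
    have : Module.Finite k (TwistedTruncated k W p e) := inferInstance
    obtain ⟨m, ⟨ε'⟩⟩ := exists_covariants_equiv ρ σ (TwistedTruncated k W p e)
      ((ρ.symTruncated (p ^ e)).frobeniusTwist p (-(e : ℤ))) fun U _ _ υ hυ h => by
        obtain ⟨l, h⟩ := ρ.occursIn_symPow_of_occursIn_symTruncated p hυ h
        have := hυ.moduleFinite
        obtain ⟨i, ⟨e⟩⟩ := hall _ υ.coordinates (υ.equivCoordinates.isIrreducible hυ)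
          ⟨l, _, h.congr υ.equivCoordinates.symm⟩
        exact ⟨i, ⟨υ.equivCoordinates.trans e⟩⟩
    exact ⟨m, ⟨ε.trans ε'⟩⟩
  · obtain ⟨l, f, h⟩ := hocc i
    obtain ⟨e, h⟩ := ρ.exists_occursIn_symTruncated p hp (hirr i) h
    obtain ⟨ε⟩ := ρ.nonempty_frobeniusModule_equiv_covariants (p := p) (e := e) hG
    exact ⟨e, (ρ.isDirectSummandOf_covariants h).congr ε.symm⟩

end Representation

/-! ### Characters, weight spaces and weight bases -/

namespace CharacterGroup

variable {k H : Type*} [Field k] [CommRing H] [HopfAlgebra k H]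

theorem val_add (χ ψ : CharacterGroup k H) : val (χ + ψ) = val χ * val ψ := rfl

theorem val_zero : val (0 : CharacterGroup k H) = 1 := rfl

theorem val_injective : Function.Injective (val : CharacterGroup k H → H) :=
  GroupLike.val_injective

theorem val_nsmul (n : ℕ) (χ : CharacterGroup k H) : val (n • χ) = val χ ^ n := rfl

theorem val_neg_mul (χ : CharacterGroup k H) : val (-χ) * val χ = 1 := by
  rw [← val_add, neg_add_cancel, val_zero]

end CharacterGroup

namespace Coaction

open Module SymmetricAlgebra

variable {k H W κ : Type*} [Field k] [CommRing H] [HopfAlgebra k H] [AddCommGroup W] [Module k W]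
  (ρ : Coaction k H W)

/-- The vectors of weight `χ` in the symmetric algebra. -/
def weightSpace (χ : CharacterGroup k H) : Submodule ρ.symInvariants (SymmetricAlgebra k W) where
  carrier := {s | ρ.sym s = s ⊗ₜ χ.val}
  add_mem' {s t} hs ht := by
    simp only [Set.mem_ofPred_eq] at *
    rw [map_add, hs, ht, TensorProduct.add_tmul]
  zero_mem' := by simp
  smul_mem' r s hs := by
    have hr : ρ.sym r.1 = r.1 ⊗ₜ 1 := r.2
    simp only [Set.mem_ofPred_eq] at *
    change ρ.sym (r.1 * s) = (r.1 * s) ⊗ₜ χ.val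
    rw [map_mul, hr, hs, Algebra.TensorProduct.tmul_mul_tmul, one_mul]

theorem mem_weightSpace {χ : CharacterGroup k H} {s : SymmetricAlgebra k W} :
    s ∈ ρ.weightSpace χ ↔ ρ.sym s = s ⊗ₜ χ.val := Iff.rfl

/-- The coefficient maps of a tensor product with a based vector space. -/
def coefficient {S H ι : Type*} [AddCommGroup S] [Module k S] [AddCommGroup H] [Module k H]
    (B : Basis ι k S) (m : ι) : S ⊗[k] H →ₗ[k] H :=
  TensorProduct.lid k H ∘ₗ (B.coord m).rTensor H

theorem coefficient_tmul {S H ι : Type*} [AddCommGroup S] [Module k S] [AddCommGroup H]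
    [Module k H] (B : Basis ι k S) (m : ι) (s : S) (h : H) :
    coefficient B m (s ⊗ₜ[k] h) = B.repr s m • h := rfl

section Covariants

theorem symTensor_rep_tmul_one (χ : CharacterGroup k H) (s : SymmetricAlgebra k W) :
    ρ.symTensor χ.rep (s ⊗ₜ 1) =
      ((TensorProduct.rid k (SymmetricAlgebra k W)).symm.toLinearMap.rTensor H)
        (ρ.sym s * 1 ⊗ₜ χ.val) := by
  have : (LinearMap.mul' k H).lTensor (SymmetricAlgebra k W ⊗[k] k) ∘ₗ
      (TensorProduct.tensorTensorTensorComm k (SymmetricAlgebra k W) H k H).toLinearMap ∘ₗ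
        (TensorProduct.mk k (SymmetricAlgebra k W ⊗[k] H) (k ⊗[k] H)).flip (1 ⊗ₜ χ.val) =
      (TensorProduct.rid k (SymmetricAlgebra k W)).symm.toLinearMap.rTensor H ∘ₗ
        LinearMap.mulRight k ((1 : SymmetricAlgebra k W) ⊗ₜ[k] χ.val) :=
    TensorProduct.ext' fun a h => by simp
  exact LinearMap.congr_fun this (ρ.sym s)

/-- The coaction on s ⊗ 1 multiplies that of s by the group-like element of -χ; cancelling this unit
turns invariance into weight χ. -/
theorem tmul_one_mem_covariants_iff (χ : CharacterGroup k H) (s : SymmetricAlgebra k W) :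
    s ⊗ₜ 1 ∈ ρ.covariants (-χ).rep ↔ s ∈ ρ.weightSpace χ := by
  have hinj : Function.Injective
      ((TensorProduct.rid k (SymmetricAlgebra k W)).symm.toLinearMap.rTensor H) :=
    ((TensorProduct.rid k (SymmetricAlgebra k W)).symm.rTensor H).injective
  change ρ.symTensor _ (s ⊗ₜ 1) = (s ⊗ₜ 1) ⊗ₜ 1 ↔ _
  rw [symTensor_rep_tmul_one]
  have : ((s ⊗ₜ 1) ⊗ₜ 1 : (SymmetricAlgebra k W ⊗[k] k) ⊗[k] H) =
    ((TensorProduct.rid k (SymmetricAlgebra k W)).symm.toLinearMap.rTensor H) (s ⊗ₜ 1) := rfl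
  rw [this, hinj.eq_iff, mem_weightSpace]
  constructor
  · intro h
    have := congrArg (· * (1 : SymmetricAlgebra k W) ⊗ₜ[k] χ.val) h
    rwa [mul_assoc, Algebra.TensorProduct.tmul_mul_tmul, CharacterGroup.val_neg_mul, one_mul,
      ← Algebra.TensorProduct.one_def, mul_one, Algebra.TensorProduct.tmul_mul_tmul, one_mul,
      mul_one] at this
  · intro h
    rw [h, Algebra.TensorProduct.tmul_mul_tmul, mul_comm χ.val, CharacterGroup.val_neg_mul,
      mul_one]

/-- The module of covariants of `L_{-χ}` is the space of vectors of weight `χ`. -/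
def weightSpaceEquiv (χ : CharacterGroup k H) :
    ρ.weightSpace χ ≃ₗ[ρ.symInvariants] ρ.covariants (-χ).rep where
  toFun s := ⟨s.1 ⊗ₜ 1, (ρ.tmul_one_mem_covariants_iff χ s.1).2 s.2⟩
  map_add' s t := Subtype.ext (TensorProduct.add_tmul _ _ _)
  map_smul' r s := rfl
  invFun x := ⟨TensorProduct.rid k _ x.1, by
    rw [← tmul_one_mem_covariants_iff]
    convert x.2
    exact (TensorProduct.rid k _).symm_apply_apply x.1⟩
  left_inv s := Subtype.ext ((TensorProduct.rid k _).apply_symm_apply s.1)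
  right_inv x := Subtype.ext ((TensorProduct.rid k _).symm_apply_apply x.1)

end Covariants

/-- The basis `b` consists of weight vectors with weights `α`. -/
def IsWeightBasis (b : Basis κ k W) (α : κ → CharacterGroup k H) : Prop :=
  ∀ i, ρ.toLinearMap (b i) = b i ⊗ₜ (α i).val

variable {ρ} {b : Basis κ k W} {α : κ → CharacterGroup k H}

namespace IsWeightBasis

variable (hb : ρ.IsWeightBasis b α)

include hb

theorem sym_monomial (m : κ →₀ ℕ) : ρ.sym (b.symmetricAlgebra m) =
    b.symmetricAlgebra m ⊗ₜ (Finsupp.linearCombination ℕ α m).val := by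
  induction m using Finsupp.induction_linear with
  | zero => simp [monomial_zero, CharacterGroup.val_zero, Algebra.TensorProduct.one_def]
  | add m n hm hn =>
    rw [monomial_add, map_mul, hm, hn, map_add, CharacterGroup.val_add,
      Algebra.TensorProduct.tmul_mul_tmul]
  | single i n =>
    have : Finsupp.single i n = n • Finsupp.single i 1 := by simp
    rw [this, monomial_nsmul, monomial_single, map_pow, map_nsmul,
      Finsupp.linearCombination_single, one_smul, CharacterGroup.val_nsmul,
      ← Algebra.TensorProduct.tmul_pow]
    congr 1
    rw [sym, SymmetricAlgebra.lift_ι_apply, LinearMap.comp_apply, hb i, LinearMap.rTensor_tmul]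

/-- Linear in s, hence checked on monomials. It lets weights be read off one monomial at a time: if
s has weight χ and x^m occurs in s, then χ and the weight of x^m agree after multiplication by a
nonzero scalar. -/
theorem coefficient_sym (m : κ →₀ ℕ) (s : SymmetricAlgebra k W) :
    coefficient b.symmetricAlgebra m (ρ.sym s) =
      b.symmetricAlgebra.repr s m • (Finsupp.linearCombination ℕ α m).val := by
  have : coefficient b.symmetricAlgebra m ∘ₗ ρ.sym.toLinearMap =
      LinearMap.toSpanSingleton k H (Finsupp.linearCombination ℕ α m).val ∘ₗ
        b.symmetricAlgebra.coord m := by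
    refine b.symmetricAlgebra.ext fun n => ?_
    simp only [LinearMap.comp_apply, AlgHom.toLinearMap_apply, hb.sym_monomial, coefficient_tmul,
      Basis.repr_self, Basis.coord_apply, LinearMap.toSpanSingleton_apply]
    by_cases h : n = m
    · rw [h]
    · rw [Finsupp.single_eq_of_ne (Ne.symm h), zero_smul, zero_smul]
  exact LinearMap.congr_fun this s

theorem mem_weightSpace_iff (χ : CharacterGroup k H) (s : SymmetricAlgebra k W) :
    s ∈ ρ.weightSpace χ ↔
      ∀ m, b.symmetricAlgebra.repr s m ≠ 0 → Finsupp.linearCombination ℕ α m = χ := by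
  constructor
  · intro h m hm
    have := hb.coefficient_sym m s
    rw [h, coefficient_tmul] at this
    exact (CharacterGroup.val_injective (smul_right_injective H hm this)).symm
  · intro h
    have hs : s ∈ Submodule.span k
        (b.symmetricAlgebra '' {m | Finsupp.linearCombination ℕ α m = χ}) := by
      rw [Basis.mem_span_image]
      exact fun m hm => h m (Finsupp.mem_support_iff.1 hm)
    rw [mem_weightSpace]
    clear h
    induction hs using Submodule.span_induction with
    | zero => rw [map_zero, TensorProduct.zero_tmul]
    | add s t _ _ hs ht => rw [map_add, hs, ht, TensorProduct.add_tmul]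
    | smul c s _ hs => rw [map_smul, hs, TensorProduct.smul_tmul']
    | mem s hs =>
      obtain ⟨m, rfl, rfl⟩ := hs
      exact hb.sym_monomial m

theorem mem_symInvariants_iff (s : SymmetricAlgebra k W) :
    s ∈ ρ.symInvariants ↔
      ∀ m, b.symmetricAlgebra.repr s m ≠ 0 → Finsupp.linearCombination ℕ α m = 0 :=
  hb.mem_weightSpace_iff 0 s

theorem isWeightOfSymPow (m : κ →₀ ℕ) :
    ρ.IsWeightOfSymPow m.degree (Finsupp.linearCombination ℕ α m) :=
  ⟨_, monomial_mem_symPow b m, b.symmetricAlgebra.ne_zero m, hb.sym_monomial m⟩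

theorem exists_exponent {l : ℕ} {χ : CharacterGroup k H} (h : ρ.IsWeightOfSymPow l χ) :
    ∃ m, Finsupp.linearCombination ℕ α m = χ := by
  obtain ⟨s, -, hs, h⟩ := h
  obtain ⟨m, hm⟩ := Finsupp.ne_iff.1 ((LinearEquiv.map_ne_zero_iff b.symmetricAlgebra.repr).2 hs)
  exact ⟨m, (hb.mem_weightSpace_iff χ s).1 h m hm⟩

end IsWeightBasis

end Coaction

/-- Vanishing factors may be dropped from a finite product of modules. -/
theorem exists_pi_equiv_of_subsingleton {R ι : Type*} [Semiring R] [Finite ι] (A : ι → Type*)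
    [∀ i, AddCommMonoid (A i)] [∀ i, Module R (A i)] (J : Set ι)
    (hJ : ∀ i ∉ J, Subsingleton (A i)) :
    ∃ (n : ℕ) (o : Fin n → ι), (∀ t, o t ∈ J) ∧
      Nonempty (((i : ι) → A i) ≃ₗ[R] ((t : Fin n) → A (o t))) := by
  classical
  obtain ⟨n, ⟨ε⟩⟩ := Finite.exists_equiv_fin J
  let f : ((i : ι) → A i) →ₗ[R] ((j : J) → A j) := LinearMap.pi fun j => LinearMap.proj j.1
  have hf : Function.Bijective f := by
    constructor
    · intro x y h
      ext1 i
      by_cases hi : i ∈ J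
      · exact congrFun h ⟨i, hi⟩
      · have := hJ i hi
        exact Subsingleton.elim _ _
    · intro y
      refine ⟨fun i => if h : i ∈ J then y ⟨i, h⟩ else 0, ?_⟩
      ext1 j
      exact dif_pos j.2
  exact ⟨n, fun t => (ε.symm t).1, fun t => (ε.symm t).2, ⟨(LinearEquiv.ofBijective f hf).trans
    (LinearEquiv.piCongrLeft R (fun j : J => A j) ε.symm).symm⟩⟩

/-! ### Decomposition of ᵉR along a weight basis -/

namespace Coaction

open Module SymmetricAlgebra

variable {k H W κ : Type*} [Field k] [CommRing H] [HopfAlgebra k H] [AddCommGroup W] [Module k W]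
  (ρ : Coaction k H W) (p e : ℕ) [ExpChar k p] (b : Basis κ k W)

/-- The elements `s` of the symmetric algebra such that `s ^ q xʳ` is invariant. -/
def residual [Finite κ] (r : Box κ (p ^ e)) : Submodule ρ.symInvariants (SymmetricAlgebra k W) where
  carrier := {s | s ^ p ^ e * b.symmetricAlgebra r.exp ∈ ρ.symInvariants}
  add_mem' {s t} hs ht := by
    rw [Set.mem_ofPred_eq, add_pow_expChar_pow, add_mul]
    exact add_mem hs ht
  zero_mem' := by
    rw [Set.mem_ofPred_eq, zero_pow (expChar_pow_pos k p e).ne', zero_mul]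
    exact zero_mem _
  smul_mem' r s hs := by
    change (r.1 * s) ^ p ^ e * _ ∈ ρ.symInvariants
    rw [mul_pow, mul_assoc]
    exact mul_mem (pow_mem r.2 _) hs

theorem mem_residual [Finite κ] {r : Box κ (p ^ e)} {s : SymmetricAlgebra k W} :
    s ∈ ρ.residual p e b r ↔ s ^ p ^ e * b.symmetricAlgebra r.exp ∈ ρ.symInvariants := Iff.rfl

variable {ρ p e b} {α : κ → CharacterGroup k H}

namespace IsWeightBasis

variable (hb : ρ.IsWeightBasis b α)

include hb

theorem mem_residual_iff [Finite κ] (r : Box κ (p ^ e)) (s : SymmetricAlgebra k W) :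
    s ∈ ρ.residual p e b r ↔ ∀ m, b.symmetricAlgebra.repr s m ≠ 0 →
      p ^ e • Finsupp.linearCombination ℕ α m + Finsupp.linearCombination ℕ α r.exp = 0 := by
  have hq := expChar_pow_pos k p e
  rw [mem_residual, hb.mem_symInvariants_iff]
  constructor
  · intro h m hm
    rw [← map_nsmul, ← map_add]
    refine h _ ?_
    obtain ⟨h₁, h₂⟩ := (nsmul_add_exp_eq_iff hq m _ r).1 rfl
    rw [repr_pow_mul_monomial, ← h₁, if_pos h₂]
    exact pow_ne_zero _ hm
  · intro h n hn
    rw [repr_pow_mul_monomial] at hn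
    split_ifs at hn with hr
    · rw [← nsmul_expDiv_add hq n, map_add, map_nsmul, ← hr]
      refine h _ fun h0 => hn ?_
      rw [h0, zero_pow hq.ne']
    · exact (hn rfl).elim

/-- A monomial x^m is allowed exactly when q times its weight equals qχ, and torsion-freeness
removes the factor q. -/
theorem residual_eq_weightSpace [Finite κ]
    (htf : ∀ n : ℕ, n ≠ 0 → ∀ χ : CharacterGroup k H, n • χ = 0 → χ = 0)
    (r : Box κ (p ^ e)) (χ : CharacterGroup k H)
    (h : p ^ e • χ + Finsupp.linearCombination ℕ α r.exp = 0) :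
    ρ.residual p e b r = ρ.weightSpace χ := by
  ext s
  rw [hb.mem_residual_iff, hb.mem_weightSpace_iff]
  refine forall₂_congr fun m _ => ?_
  rw [← h, add_left_inj]
  refine ⟨fun h => ?_, fun h => by rw [h]⟩
  rw [← sub_eq_zero]
  refine htf _ (expChar_pow_pos k p e).ne' _ ?_
  rw [smul_sub, h, sub_self]

variable [Fintype κ] [DecidableEq κ]

/-- Distinct r contribute disjoint sets of monomials, so invariance of the sum forces invariance of
each term. -/
theorem mem_residual_of_sum_mem {s : Box κ (p ^ e) → SymmetricAlgebra k W}
    (h : ∑ r, s r ^ p ^ e * b.symmetricAlgebra r.exp ∈ ρ.symInvariants) (r : Box κ (p ^ e)) :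
    s r ∈ ρ.residual p e b r := by
  rw [hb.mem_residual_iff]
  rw [hb.mem_symInvariants_iff] at h
  intro m hm
  rw [← map_nsmul, ← map_add]
  refine h _ ?_
  obtain ⟨h₁, h₂⟩ := (nsmul_add_exp_eq_iff (expChar_pow_pos k p e) m _ r).1 rfl
  rw [repr_sum_pow_mul_monomial, ← h₁, ← h₂]
  exact pow_ne_zero _ hm

omit hb in
/-- The map `(sᵣ) ↦ ∑ sᵣ ^ q xʳ` to the ring of invariants. -/
def residualSum : ((r : Box κ (p ^ e)) → ρ.residual p e b r) →ₗ[ρ.symInvariants]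
    FrobeniusModule p ρ.symInvariants e ρ.symInvariants where
  toFun s := Pullback.of _ _ (⟨∑ r, (s r).1 ^ p ^ e * b.symmetricAlgebra r.exp,
    sum_mem fun r _ => (s r).2⟩ : ρ.symInvariants)
  map_add' s t := by
    rw [← (Pullback.of _ ρ.symInvariants).map_add]
    refine congrArg (Pullback.of _ ρ.symInvariants) (Subtype.ext ?_)
    exact (frobeniusSum b p e).map_add (fun r => (s r).1) (fun r => (t r).1)
  map_smul' a s := by
    refine congrArg (Pullback.of _ ρ.symInvariants) (Subtype.ext ?_)
    exact (frobeniusSum b p e).map_smul a.1 (fun r => (s r).1)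

variable [PerfectField k]

theorem residualSum_bijective :
    Function.Bijective (residualSum (ρ := ρ) (p := p) (e := e) (b := b)) := by
  constructor
  · intro s t h
    have h' : frobeniusSum b p e (fun r => (s r).1) = frobeniusSum b p e (fun r => (t r).1) :=
      congrArg Subtype.val ((Pullback.of _ ρ.symInvariants).injective h)
    ext1 r
    exact Subtype.ext (congrFun (frobeniusSum_injective b e h') r)
  · intro a
    have : PerfectRing k p := inferInstance
    obtain ⟨a, rfl⟩ := (Pullback.of _ ρ.symInvariants).surjective a
    obtain ⟨s, hs⟩ := frobeniusSum_surjective (p := p) b e (Pullback.of _ _ a.1)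
    replace hs : ∑ r, s r ^ p ^ e * b.symmetricAlgebra r.exp = a.1 := hs
    have hmem := hb.mem_residual_of_sum_mem (s := s) (by rw [hs]; exact a.2)
    exact ⟨fun r => ⟨s r, hmem r⟩, congrArg (Pullback.of _ ρ.symInvariants) (Subtype.ext hs)⟩

theorem isDirectSummandOf_residual (r : Box κ (p ^ e)) :
    IsDirectSummandOf ρ.symInvariants (ρ.residual p e b r)
      (FrobeniusModule p ρ.symInvariants e ρ.symInvariants) := by
  let ε := LinearEquiv.ofBijective _ (hb.residualSum_bijective (p := p) (e := e))
  have h : IsDirectSummandOf ρ.symInvariants (ρ.residual p e b r)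
      ((r : Box κ (p ^ e)) → ρ.residual p e b r) :=
    ⟨LinearMap.single ρ.symInvariants (fun r => ρ.residual p e b r) r, LinearMap.proj r,
      LinearMap.proj_comp_single_same _ _ r⟩
  exact h.congr ε

/-- A nonzero residual contains an element in which some x^m occurs; the weight of x^m solves the
equation for χ and is a weight of a symmetric power. The vanishing residuals are discarded. -/
theorem exists_equiv_pi_weightSpace
    (htf : ∀ n : ℕ, n ≠ 0 → ∀ χ : CharacterGroup k H, n • χ = 0 → χ = 0) :
    ∃ (n : ℕ) (χ : Fin n → CharacterGroup k H) (r : Fin n → Box κ (p ^ e)),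
      (∀ i, p ^ e • χ i + Finsupp.linearCombination ℕ α (r i).exp = 0 ∧
        ∃ l, ρ.IsWeightOfSymPow l (χ i)) ∧
      Nonempty (FrobeniusModule p ρ.symInvariants e ρ.symInvariants ≃ₗ[ρ.symInvariants]
        ((i : Fin n) → ρ.weightSpace (χ i))) := by
  let J : Set (Box κ (p ^ e)) := {r | ∃ χ : CharacterGroup k H,
    p ^ e • χ + Finsupp.linearCombination ℕ α r.exp = 0 ∧ ∃ l, ρ.IsWeightOfSymPow l χ}
  have hJ (r) (hr : r ∉ J) : Subsingleton (ρ.residual p e b r) := by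
    refine subsingleton_of_forall_eq 0 fun s => Subtype.ext ?_
    by_contra hs
    obtain ⟨m, hm⟩ :=
      Finsupp.ne_iff.1 ((LinearEquiv.map_ne_zero_iff b.symmetricAlgebra.repr).2 hs)
    exact hr ⟨_, (hb.mem_residual_iff r s.1).1 s.2 m hm, _, hb.isWeightOfSymPow m⟩
  obtain ⟨n, o, ho, ⟨ε⟩⟩ := exists_pi_equiv_of_subsingleton (R := ρ.symInvariants)
    (fun r => ρ.residual p e b r) J hJ
  choose χ hχ hw using ho
  let ε' := LinearEquiv.ofBijective _ (hb.residualSum_bijective (p := p) (e := e))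
  refine ⟨n, χ, o, fun i => ⟨hχ i, hw i⟩, ⟨(ε'.symm.trans ε).trans (LinearEquiv.piCongrRight
    fun i => LinearEquiv.ofEq _ _ (hb.residual_eq_weightSpace htf (o i) (χ i) (hχ i)))⟩⟩

end IsWeightBasis

end Coaction

/-! ### Split tori and strongly critical characters -/

namespace CharacterGroup

variable {k H : Type*} [Field k] [CommRing H] [HopfAlgebra k H]

/-- Over a field, the group-like elements of a group algebra are exactly the group elements. -/
theorem exists_embedding (hH : IsSplitTorus k H) :
    ∃ (r : ℕ) (φ : CharacterGroup k H →+ (Fin r → ℤ)), Function.Injective φ := by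
  obtain ⟨r, ⟨g⟩⟩ := hH
  have h (χ : CharacterGroup k H) :
      ∃ n : Fin r → ℤ, AddMonoidAlgebra.single n (1 : k) = g χ.val := by
    have := (Additive.toMul χ).isGroupLikeElem_val.map g
    exact AddMonoidAlgebra.isGroupLikeElem_iff_mem_range_single_one.1 this
  choose n hn using h
  have hinj := AddMonoidAlgebra.single_left_injective (M := Fin r → ℤ) (one_ne_zero (α := k))
  refine ⟨r, AddMonoidHom.mk' n fun χ ψ => hinj ?_, fun χ ψ h => val_injective (g.injective ?_)⟩
  · dsimp only
    rw [hn, val_add, map_mul, ← hn, ← hn, AddMonoidAlgebra.single_mul_single, one_mul]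
  · change g χ.val = g ψ.val
    rw [← hn, ← hn]
    exact congrArg (fun m => AddMonoidAlgebra.single m (1 : k)) h

/-- The extension of an additive map to rational coefficients. -/
def rationalExtension (φ : CharacterGroup k H →+ ℤ) : ℚ ⊗[ℤ] CharacterGroup k H →ₗ[ℤ] ℚ :=
  TensorProduct.lift (LinearMap.mk₂ ℤ (fun a χ => a * (φ χ : ℚ))
    (fun a b χ => add_mul _ _ _) (fun c a χ => by simp [mul_assoc])
    (fun a χ ψ => by rw [map_add]; push_cast; ring)
    (fun c a χ => by rw [map_zsmul]; simp; ring))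

theorem rationalExtension_tmul (φ : CharacterGroup k H →+ ℤ) (a : ℚ) (χ : CharacterGroup k H) :
    rationalExtension φ (a ⊗ₜ χ) = a * φ χ := rfl

end CharacterGroup

namespace Coaction

open Module SymmetricAlgebra

variable {k H W : Type*} [Field k] [CommRing H] [HopfAlgebra k H] [AddCommGroup W] [Module k W]
  (ρ : Coaction k H W)

/-- Expand the coaction of w as ∑ f_n ⊗ K_n over the group-like basis. Coassociativity says that f_n
has weight K_n, and the counit axiom says w = ∑ f_n. -/
theorem span_weight_vectors_eq_top (hH : IsSplitTorus k H) :
    Submodule.span k {w | ∃ χ : CharacterGroup k H, ρ.toLinearMap w = w ⊗ₜ χ.val} = ⊤ := by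
  obtain ⟨r, ⟨g⟩⟩ := hH
  let K : Basis (Fin r → ℤ) k H :=
    ⟨g.toLinearEquiv.trans (AddMonoidAlgebra.coeffLinearEquiv k)⟩
  have hK (n) : IsGroupLikeElem k (K n) := by
    have h : K n = g.symm (AddMonoidAlgebra.single n 1) := rfl
    rw [h]
    exact (AddMonoidAlgebra.isGroupLikeElem_single_one n).map g.symm
  let c (n) : CharacterGroup k H := Additive.ofMul ⟨K n, hK n⟩
  rw [eq_top_iff]
  rintro w -
  obtain ⟨f, hf⟩ := TensorProduct.eq_repr_basis_right K (ρ.toLinearMap w)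
  have hw (n) : ρ.toLinearMap (f n) = f n ⊗ₜ (c n).val := by
    by_cases hn : f n = 0
    · rw [hn, map_zero, TensorProduct.zero_tmul]
    have h := LinearMap.congr_fun ρ.coassoc w
    simp only [LinearMap.comp_apply, ← hf, Finsupp.sum, map_sum, LinearMap.rTensor_tmul,
      LinearMap.lTensor_tmul, (hK _).comul_eq_tmul_self] at h
    -- Extracts the coefficient of K_n in the last tensor factor.
    have h' := congrArg (fun x => TensorProduct.equivFinsuppOfBasisRight K
      ((TensorProduct.assoc k W H H).symm x) n) h
    simp only [map_sum, LinearEquiv.coe_coe, LinearEquiv.symm_apply_apply,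
      TensorProduct.assoc_symm_tmul, Finsupp.finsetSum_apply,
      TensorProduct.equivFinsuppOfBasisRight_apply_tmul_apply, Basis.repr_self] at h'
    rw [Finset.sum_eq_single n, Finset.sum_eq_single n] at h'
    · have h'' : ρ.toLinearMap (f n) = f n ⊗ₜ K n := by simpa using h'
      exact h''
    all_goals
      intros
      simp_all
  have hsum : w = f.sum fun n v => v := by
    have := LinearMap.congr_fun ρ.counit w
    simp only [LinearMap.comp_apply, LinearMap.id_apply, ← hf] at this
    rw [← this, Finsupp.sum, map_sum]
    simp [Finsupp.sum, (hK _).counit_eq_one]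
  rw [hsum]
  exact Submodule.sum_mem _ fun n _ => Submodule.subset_span ⟨c n, hw n⟩

theorem exists_isWeightBasis [Module.Finite k W] (hH : IsSplitTorus k H) :
    ∃ (b : Basis (Fin (finrank k W)) k W) (α : Fin (finrank k W) → CharacterGroup k H),
      ρ.IsWeightBasis b α := by
  have h := (ρ.span_weight_vectors_eq_top hH).ge
  let b := Basis.ofSpan h
  have hb (i) : ∃ χ : CharacterGroup k H, ρ.toLinearMap (b i) = b i ⊗ₜ χ.val :=
    Basis.ofSpan_subset h ⟨i, rfl⟩
  have := Module.Finite.finite_basis b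
  have := Fintype.ofFinite ((linearIndepOn_empty k id).extend (Set.empty_subset
    {w | ∃ χ : CharacterGroup k H, ρ.toLinearMap w = w ⊗ₜ χ.val}))
  let ε := Fintype.equivFinOfCardEq (finrank_eq_card_basis b).symm
  choose α hα using hb
  refine ⟨b.reindex ε, fun i => α (ε.symm i), fun i => ?_⟩
  rw [Basis.reindex_apply]
  exact hα _

variable {ρ}

/-- Pairing with integer-valued functionals replaces the relation in ℚ ⊗ X(G) by numerical
identities. -/
theorem IsStronglyCritical.exists_isWeightBasis {χ : CharacterGroup k H}
    (h : ρ.IsStronglyCritical χ) :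
    ∃ (b : Basis (Fin (finrank k W)) k W) (α : Fin (finrank k W) → CharacterGroup k H)
      (u : Fin (finrank k W) → ℚ), ρ.IsWeightBasis b α ∧ (∀ i, u i ∈ Set.Ioc (-1 : ℚ) 0) ∧
      ∀ φ : CharacterGroup k H →+ ℤ, (φ χ : ℚ) = ∑ i, u i * φ (α i) := by
  obtain ⟨b, α, hb, u, hu, h⟩ := h
  refine ⟨b, α, u, hb, hu, fun φ => ?_⟩
  have := congrArg (CharacterGroup.rationalExtension φ) h
  simpa only [map_sum, CharacterGroup.rationalExtension_tmul, one_mul] using this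

/-- Take u_i = -r_i/q; it lies in ]-1, 0] because 0 ≤ r_i < q. -/
theorem IsWeightBasis.isStronglyCritical {b : Basis (Fin (finrank k W)) k W}
    {α : Fin (finrank k W) → CharacterGroup k H} (hb : ρ.IsWeightBasis b α) {q : ℕ} (hq : 0 < q)
    (r : Box (Fin (finrank k W)) q) {χ : CharacterGroup k H}
    (h : q • χ + Finsupp.linearCombination ℕ α r.exp = 0) : ρ.IsStronglyCritical χ := by
  have hq' : (0 : ℚ) < q := by exact_mod_cast hq
  refine ⟨b, α, hb, fun i => -((r i : ℕ) : ℚ) / q, fun i => ⟨?_, ?_⟩, ?_⟩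
  · rw [lt_div_iff₀ hq', neg_one_mul, neg_lt_neg_iff]
    exact_mod_cast (r i).2
  · dsimp only
    rw [neg_div, neg_nonpos]
    positivity
  · have hχ : (q : ℤ) • χ = ∑ i, (-(r i : ℕ) : ℤ) • α i := by
      rw [natCast_zsmul, eq_neg_of_add_eq_zero_left h, Finsupp.linearCombination_apply,
        Finsupp.sum_fintype _ (fun i a => a • α i) (fun i => zero_smul _ _), ← Finset.sum_neg_distrib]
      simp
    have h1 : (1 : ℚ) ⊗ₜ[ℤ] χ = (q : ℚ)⁻¹ ⊗ₜ[ℤ] ((q : ℤ) • χ) := by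
      rw [← TensorProduct.smul_tmul, zsmul_eq_mul, Int.cast_natCast, mul_inv_cancel₀ hq'.ne']
    rw [h1, hχ, TensorProduct.tmul_sum]
    refine Finset.sum_congr rfl fun i _ => ?_
    rw [← TensorProduct.smul_tmul, zsmul_eq_mul]
    congr 1

/-- With χ = ∑ m_i α_i and u_i = -a_i/N one has Nχ = -∑ a_i α_i, so N m + a is a relation among the
α_i. Rounding is needed because N need not divide a power of p. Subtracting q m from a multiple c(N
m + a), with c just above q/N, gives the remainders r_i = (cN - q) m_i + c a_i, close to q a_i/N <
q. -/
theorem exists_nsmul_add_eq_zero {κ X : Type*} [Fintype κ] [AddCommGroup X] {s p : ℕ}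
    {φ : X →+ (Fin s → ℤ)} (hφ : Function.Injective φ) (hp : 1 < p) {α : κ → X} (m : κ →₀ ℕ)
    {u : κ → ℚ} (hu : ∀ i, u i ∈ Set.Ioc (-1 : ℚ) 0)
    (h : ∀ j, (φ (Finsupp.linearCombination ℕ α m) j : ℚ) = ∑ i, u i * φ (α i) j) :
    ∃ (e : ℕ) (r : Box κ (p ^ e)), p ^ e • Finsupp.linearCombination ℕ α m +
      Finsupp.linearCombination ℕ α r.exp = 0 := by
  have hlc (n : κ →₀ ℕ) (j) :
      φ (Finsupp.linearCombination ℕ α n) j = ∑ i, (n i : ℤ) * φ (α i) j := by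
    rw [Finsupp.linearCombination_apply, Finsupp.sum_fintype _ (fun i a => a • α i)
      (fun i => zero_smul _ _), map_sum, Finset.sum_apply]
    simp
  obtain ⟨N, hN, a, ha⟩ : ∃ N : ℕ, 0 < N ∧ ∃ a : κ → ℕ, ∀ i, (a i : ℚ) = -u i * N := by
    refine ⟨∏ i, (u i).den, Finset.prod_pos fun i _ => (u i).den_pos, ?_⟩
    have (i : κ) : ∃ a : ℕ, (a : ℚ) = -u i * (∏ j, (u j).den : ℕ) := by
      obtain ⟨t, ht⟩ := Finset.dvd_prod_of_mem (fun i => (u i).den) (Finset.mem_univ i)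
      refine ⟨(-(u i).num).toNat * t, ?_⟩
      have hnum : 0 ≤ -(u i).num := by
        have := Rat.num_nonpos.2 (hu i).2
        omega
      rw [ht, Nat.cast_mul, Nat.cast_mul, ← Int.cast_natCast, Int.toNat_of_nonneg hnum,
        ← mul_assoc, neg_mul, Rat.mul_den_eq_num, Int.cast_neg]
    choose a ha using this
    exact ⟨a, ha⟩
  have haN (i) : a i < N := by
    have : (a i : ℚ) < N := by
      rw [ha]
      have : (0 : ℚ) < N := by exact_mod_cast hN
      nlinarith [(hu i).1]
    exact_mod_cast this
  -- Chosen so that q > e makes c exceed N m_i + N. As c a_i ≤ cN - c ≤ q + N - c and (cN - q) m_i ≤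
  -- N m_i, this yields r_i < q.
  let e := N * (N * ((∑ i, m i) + 1))
  let q := p ^ e
  have hqe : N * (N * ((∑ i, m i) + 1)) ≤ q := (Nat.lt_pow_self hp).le
  let c := q / N + 1
  have hc₁ : q ≤ c * N := by
    have := Nat.lt_div_mul_add hN (a := q)
    rw [add_mul, one_mul]
    exact this.le
  have hc₂ : c * N ≤ q + N := by
    have := Nat.div_mul_le_self q N
    rw [add_mul, one_mul]
    omega
  have hc₃ (i) : N * m i + N < c := by
    have h₁ : N * ((∑ i, m i) + 1) ≤ q / N := (Nat.le_div_iff_mul_le hN).2 (by linarith)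
    have h₂ : m i ≤ ∑ i, m i := Finset.single_le_sum (fun _ _ => Nat.zero_le _) (Finset.mem_univ i)
    have h₃ := Nat.mul_le_mul_left N h₂
    rw [mul_add, mul_one] at h₁
    omega
  have hle (i) : q * m i ≤ c * (N * m i + a i) := by
    have := Nat.mul_le_mul_right (m i) hc₁
    nlinarith [Nat.zero_le (c * a i)]
  have hlt (i) : c * (N * m i + a i) < q * m i + q := by
    have h₁ := Nat.mul_le_mul_right (m i) hc₂
    have h₂ := Nat.mul_le_mul_left c (haN i)
    have h₃ := hc₃ i
    rw [Nat.succ_eq_add_one] at h₂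
    nlinarith
  refine ⟨e, fun i => ⟨c * (N * m i + a i) - q * m i, by
    have := hlt i
    have := hle i
    change _ < q
    omega⟩, hφ ?_⟩
  ext j
  have hx : (φ (Finsupp.linearCombination ℕ α m) j) * N = -∑ i, (a i : ℤ) * φ (α i) j := by
    have : ((φ (Finsupp.linearCombination ℕ α m) j : ℤ) : ℚ) * N =
        -∑ i, (a i : ℚ) * φ (α i) j := by
      rw [h j, Finset.sum_mul, ← Finset.sum_neg_distrib]
      refine Finset.sum_congr rfl fun i _ => ?_
      rw [ha]
      ring
    exact_mod_cast this
  rw [map_add, map_nsmul, Pi.add_apply, Pi.smul_apply, hlc (Box.exp _), nsmul_eq_mul]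
  have hr : ∑ i, ((c * (N * m i + a i) - q * m i : ℕ) : ℤ) * φ (α i) j =
      c * (N * ∑ i, (m i : ℤ) * φ (α i) j + ∑ i, (a i : ℤ) * φ (α i) j) -
        q * ∑ i, (m i : ℤ) * φ (α i) j := by
    have hcast (i : κ) : ((c * (N * m i + a i) - q * m i : ℕ) : ℤ) = c * (N * m i + a i) - q * m i := by
      rw [Nat.cast_sub (hle i)]
      push_cast
      ring
    simp only [hcast]
    rw [Finset.mul_sum, ← Finset.sum_add_distrib, Finset.mul_sum, Finset.mul_sum,
      ← Finset.sum_sub_distrib]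
    exact Finset.sum_congr rfl fun i _ => by ring
  change ((q : ℕ) : ℤ) * _ + ∑ i, ((c * (N * m i + a i) - q * m i : ℕ) : ℤ) * φ (α i) j = _
  rw [hr, ← hlc m j, map_zero, Pi.zero_apply]
  linear_combination (c : ℤ) * hx

/-- Since |u_i| ≤ 1, the coordinates of χ in ℤ^s are bounded in terms of the weights of W. -/
theorem finite_isStronglyCritical [Module.Finite k W] (hH : IsSplitTorus k H) :
    {χ : CharacterGroup k H | ρ.IsStronglyCritical χ}.Finite := by
  obtain ⟨s, φ, hφ⟩ := CharacterGroup.exists_embedding hH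
  obtain ⟨b₀, α₀, hb₀⟩ := ρ.exists_isWeightBasis hH
  -- A crude bound: each of the d weights is estimated by the sum over all α₀, so multiplicities
  -- need not be matched between two weight bases.
  let C : Fin s → ℤ := fun j => ∑ _i : Fin (finrank k W), ∑ i, |φ (α₀ i) j|
  refine ((Set.finite_Icc (-C) C).preimage hφ.injOn).subset fun χ hχ => ?_
  obtain ⟨b, α, u, hb, hu, h⟩ := hχ.exists_isWeightBasis
  -- A weight vector has the weight of any basis vector occurring in its expansion.
  have hα (i) : ∃ i₀, α i = α₀ i₀ := by
    obtain ⟨i₀, hi₀⟩ := Finsupp.ne_iff.1 ((LinearEquiv.map_ne_zero_iff b₀.repr).2 (b.ne_zero i))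
    refine ⟨i₀, CharacterGroup.val_injective (smul_right_injective H hi₀ ?_)⟩
    have h₁ : coefficient b₀ i₀ (ρ.toLinearMap (b i)) = b₀.repr (b i) i₀ • (α₀ i₀).val := by
      have : coefficient b₀ i₀ ∘ₗ ρ.toLinearMap =
          LinearMap.toSpanSingleton k H (α₀ i₀).val ∘ₗ b₀.coord i₀ := by
        refine b₀.ext fun n => ?_
        simp only [LinearMap.comp_apply, hb₀ n, coefficient_tmul, Basis.repr_self,
          Basis.coord_apply, LinearMap.toSpanSingleton_apply]
        by_cases h : n = i₀
        · rw [h]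
        · rw [Finsupp.single_eq_of_ne (Ne.symm h), zero_smul, zero_smul]
      exact LinearMap.congr_fun this (b i)
    rw [hb i, coefficient_tmul] at h₁
    exact h₁
  have hbound (j) : |φ χ j| ≤ C j := by
    have h₁ := h ((Pi.evalAddMonoidHom _ j).comp φ)
    change (φ χ j : ℚ) = ∑ i, u i * (φ (α i) j : ℤ) at h₁
    have h₂ : |(φ χ j : ℚ)| ≤ (C j : ℤ) := by
      rw [h₁]
      push_cast [C]
      refine (Finset.abs_sum_le_sum_abs _ _).trans (Finset.sum_le_sum fun i _ => ?_)
      obtain ⟨i₀, hi₀⟩ := hα i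
      rw [abs_mul, hi₀]
      refine le_trans ?_ (Finset.single_le_sum (f := fun i => |(φ (α₀ i) j : ℚ)|)
        (fun _ _ => abs_nonneg _) (Finset.mem_univ i₀))
      refine mul_le_of_le_one_left (abs_nonneg _) (abs_le.2 ⟨(hu i).1.le, ?_⟩)
      exact (hu i).2.trans zero_le_one
    exact_mod_cast h₂
  exact ⟨fun j => (abs_le.1 (hbound j)).1, fun j => (abs_le.1 (hbound j)).2⟩

theorem nsmul_eq_zero_of_isSplitTorus (hH : IsSplitTorus k H) (n : ℕ) (hn : n ≠ 0)
    (χ : CharacterGroup k H) (h : n • χ = 0) : χ = 0 := by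
  obtain ⟨s, φ, hφ⟩ := CharacterGroup.exists_embedding hH
  apply hφ
  have := congrArg φ h
  rw [map_nsmul, map_zero, smul_eq_zero] at this
  rw [map_zero]
  exact this.resolve_left hn

section Main

variable (p : ℕ) [ExpChar k p] [PerfectField k] (ρ)

theorem exists_equiv_pi_covariants [Module.Finite k W] (hH : IsSplitTorus k H) (e : ℕ) :
    ∃ (n : ℕ) (χ : Fin n → CharacterGroup k H),
      (∀ i, ρ.IsStronglyCritical (χ i) ∧ ∃ l : ℕ, ρ.IsWeightOfSymPow l (χ i)) ∧
      Nonempty (FrobeniusModule p ρ.symInvariants e ρ.symInvariants ≃ₗ[ρ.symInvariants]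
        ((i : Fin n) → ρ.covariants (-(χ i)).rep)) := by
  obtain ⟨b, α, hb⟩ := ρ.exists_isWeightBasis hH
  obtain ⟨n, χ, r, h, ⟨ε⟩⟩ := hb.exists_equiv_pi_weightSpace (p := p) (e := e)
    (nsmul_eq_zero_of_isSplitTorus hH)
  exact ⟨n, χ, fun i => ⟨hb.isStronglyCritical (expChar_pow_pos k p e) (r i) (h i).1, (h i).2⟩,
    ⟨ε.trans (LinearEquiv.piCongrRight fun i => ρ.weightSpaceEquiv (χ i))⟩⟩

/-- The weight basis is the one supplied by strong criticality, so no comparison with another basis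
is needed. The remainder r produced by rounding selects the summand of ᵉR equal to the space of
weight χ. -/
theorem exists_isDirectSummandOf (hp : 1 < p) (hH : IsSplitTorus k H) {χ : CharacterGroup k H}
    (hχ : ρ.IsStronglyCritical χ) (hw : ∃ l : ℕ, ρ.IsWeightOfSymPow l χ) :
    ∃ e : ℕ, IsDirectSummandOf ρ.symInvariants (ρ.covariants (-χ).rep)
      (FrobeniusModule p ρ.symInvariants e ρ.symInvariants) := by
  obtain ⟨s, φ, hφ⟩ := CharacterGroup.exists_embedding hH
  obtain ⟨b, α, u, hb, hu, h⟩ := hχ.exists_isWeightBasis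
  obtain ⟨l, hw⟩ := hw
  obtain ⟨m, rfl⟩ := hb.exists_exponent hw
  obtain ⟨e, r, hr⟩ := exists_nsmul_add_eq_zero hφ hp m hu
    fun j => h ((Pi.evalAddMonoidHom _ j).comp φ)
  obtain ⟨i, q, hiq⟩ := hb.isDirectSummandOf_residual (p := p) (e := e) r
  have heq := hb.residual_eq_weightSpace (nsmul_eq_zero_of_isSplitTorus hH) r _ hr
  let ε := (ρ.weightSpaceEquiv (Finsupp.linearCombination ℕ α m)).symm.trans
    (LinearEquiv.ofEq _ _ heq.symm)
  refine ⟨e, i ∘ₗ ε.toLinearMap, ε.symm.toLinearMap ∘ₗ q, ?_⟩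
  ext1 x
  have := LinearMap.congr_fun hiq (ε x)
  simp only [LinearMap.comp_apply, LinearMap.id_apply, LinearEquiv.coe_coe] at this ⊢
  rw [this, LinearEquiv.symm_apply_apply]

end Main

end Coaction

end

theorem mainTheorem7 (p : ℕ) [Fact p.Prime] (k : Type*) [Field k] [CharP k p] [PerfectField k] :
    -- finite groups of order prime to `p`
    (∀ (G : Type*) [Group G] [Finite G] (W : Type*) [AddCommGroup W] [Module k W]
        [Module.Finite k W] (ρ : Representation k G W), ¬ p ∣ Nat.card G →
      (∀ e : ℕ,
        Module.Finite k (FrobeniusTwist p k (-(e : ℤ))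
          (SymmetricAlgebra k W ⧸ (symPosFrobeniusPower k W (p ^ e)).restrictScalars k)) ∧
        Nonempty (FrobeniusModule p ρ.symInvariants e ρ.symInvariants ≃ₗ[ρ.symInvariants]
          ρ.covariants ((ρ.symTruncated (p ^ e)).frobeniusTwist p (-(e : ℤ))))) ∧
      -- `σ 0, …, σ (n - 1)` is the list of the irreducible representations occurring in some
      -- twist of some `S^l W`, up to isomorphism
      ∃ (n : ℕ) (d : Fin n → ℕ) (σ : ∀ i, Representation k G (Fin (d i) → k)),
        (∀ i, (σ i).IsIrreducible) ∧
        (∀ i, ∃ (l : ℕ) (f : ℤ), (σ i).OccursIn ((ρ.symPow l).frobeniusTwist p f)) ∧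
        (∀ i j, Nonempty ((σ i).Equiv (σ j)) → i = j) ∧
        (∀ (V : Type*) [AddCommGroup V] [Module k V] (τ : Representation k G V),
          τ.IsIrreducible →
          (∃ (l : ℕ) (f : ℤ), τ.OccursIn ((ρ.symPow l).frobeniusTwist p f)) →
          ∃ i, Nonempty (τ.Equiv (σ i))) ∧
        (∀ e : ℕ, ∃ m : Fin n → ℕ,
          Nonempty (FrobeniusModule p ρ.symInvariants e ρ.symInvariants ≃ₗ[ρ.symInvariants]
            ((i : Fin n) → Fin (m i) → ρ.covariants (σ i)))) ∧
        (∀ i, ∃ e : ℕ, IsDirectSummandOf ρ.symInvariants (ρ.covariants (σ i))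
          (FrobeniusModule p ρ.symInvariants e ρ.symInvariants))) ∧
    -- split tori
    (∀ (H : Type*) [CommRing H] [HopfAlgebra k H] (W : Type*) [AddCommGroup W] [Module k W]
        [Module.Finite k W] (ρ : Coaction k H W), IsSplitTorus k H →
      {χ : CharacterGroup k H |
        ρ.IsStronglyCritical χ ∧ ∃ l : ℕ, ρ.IsWeightOfSymPow l χ}.Finite ∧
      (∀ e : ℕ, ∃ (n : ℕ) (χ : Fin n → CharacterGroup k H),
        (∀ i, ρ.IsStronglyCritical (χ i) ∧ ∃ l : ℕ, ρ.IsWeightOfSymPow l (χ i)) ∧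
        Nonempty (FrobeniusModule p ρ.symInvariants e ρ.symInvariants ≃ₗ[ρ.symInvariants]
          ((i : Fin n) → ρ.covariants (-(χ i)).rep))) ∧
      (∀ χ : CharacterGroup k H,
        ρ.IsStronglyCritical χ → (∃ l : ℕ, ρ.IsWeightOfSymPow l χ) →
        ∃ e : ℕ, IsDirectSummandOf ρ.symInvariants (ρ.covariants (-χ).rep)
          (FrobeniusModule p ρ.symInvariants e ρ.symInvariants))) := by
  have hp : 1 < p := (Fact.out : p.Prime).one_lt
  refine ⟨fun G _ _ W _ _ _ ρ hG => ?_, fun H _ _ W _ _ _ ρ hH => ?_⟩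
  · have hG' : (Nat.card G : k) ≠ 0 := (CharP.cast_eq_zero_iff k p _).not.2 hG
    exact ⟨fun e => ⟨SymmetricAlgebra.finite_twistedTruncated p e,
      ρ.nonempty_frobeniusModule_equiv_covariants hG'⟩, ρ.exists_list_covariants p hp hG'⟩
  · exact ⟨(Coaction.finite_isStronglyCritical hH).subset fun χ h => h.1,
      fun e => ρ.exists_equiv_pi_covariants p hH e,
      fun χ hχ hw => ρ.exists_isDirectSummandOf p hp hH hχ hw⟩
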